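/- **Setting.** An origami $S$ is a connected surface obtained from finitely many copies of the unit square $[0,1]^2$ (their number is $N_S\ge 1$) by gluing right sides to left sides and top sides to bottom sides by translations. It carries a finite set $\Sigma$ of singularities, which are vertices of the tiling; $\Sigma$ contains every point of total angle $>2\pi$ and may contain vertices of angle $2\pi$ (as for the torus $\mathbb T^2=\mathbb R^2/\mathbb Z^2$, where $\Sigma=\{0\}$). For an invertible real $2\times2$ matrix $G$, $G\cdot S$ denotes the same surface with its flat coordinates composed with $G$. A saddle connection of a translation surface $X$ is a non-constant flat geodesic segment joining two points of $\Sigma$ with no point of $\Sigma$ in its interior; its holonomy is its period, and $\mathrm{Hol}(X)\subset\mathbb R^2=\mathbb C$ is the set of periods. The origami $S$ is *reduced* (primitive) if $\mathrm{Hol}(S)$ generates the group $\mathbb Z^2$. For a translation surface $X$ of area one put $$L(X)=\limsup_{v\in \mathrm{Hol}(X),\ |\mathrm{Im}\,v|\to\infty}\frac1{|\mathrm{Re}\, v|\cdot|\mathrm{Im}\, v|}\in[0,\infty],$$ and for an origami $S$ and $\alpha\in\mathbb R$ put $L(S,\alpha)=L\big(r_{\arctan\alpha}\cdot N_S^{-1/2}\cdot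 S\big)$, where $r_\theta$ is the rotation by the angle $\theta$. Let $A\in SL(2,\mathbb Z)$. The multiplicity of a saddle connection of $A\cdot S$ is the degree onto its image of its projection to $\mathbb T^2$, that is, the integer $m\geq 1$ such that its period is $m$ times a primitive integer vector. For $p/q\in\mathbb Q\cup\{\infty\}$, $m(p/q;A\cdot S)$ is the least multiplicity of a saddle connection of $A\cdot S$ parallel to $(p,q)$, with $\infty=1/0$. Put $M_S=\max_{p/q\in\mathbb Q}m(p/q;S)$. Let $T=\begin{pmatrix}1&1\\0&1\end{pmatrix}$, $R=\begin{pmatrix}0&-1\\1&0\end{pmatrix}$ and, for positive integers $a_1,\dots,a_n$, $$g(a_1,\dots,a_n)=(T^{(-1)^{n+1}a_n}R)\cdots(T^{a_3}R)(T^{-a_2}R)(T^{a_1}R).$$ Write $[a_1,a_2,\dots]=\cfrac1{a_1+\cfrac1{a_2+\cdots}}$ for finite and infinite continued fractions. For $\alpha=[a_1,a_2,\dots]$, $n\ge1$ and $1\le i\le a_n$ put $$D(n,i,\alpha)=\begin{cases}[a_n,\dots,a_1]+a_{n+1}+[a_{n+2},a_{n+3},\dots]& \text{if } i=a_n,\\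 [i,a_{n-1},\dots,a_1]+[a_n-i,a_{n+1},a_{n+2},\dots]&\text{if } 1\le i<a_n.\end{cases}$$ **Theorem.** Let $S$ be a reduced origami and let $\alpha=[a_1,a_2,\dots]\in(0,1)$ be irrational with $L(\mathbb T^2,\alpha)>M_S^2-2$. Then, as elements of $[0,\infty]$, $$L(S,\alpha)=N_S\cdot\limsup_{n\to\infty}\ \max_{1\le i\le a_n}\frac{D(n,i,\alpha)}{m^2\big(\infty;\,R\cdot g(a_1,\dots,a_{n-1},i)\cdot S\big)}.$$ -/

import Mathlib

open Filter Topology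
open scoped ENNReal MatrixGroups

noncomputable section

/-! ### Square-tiled surfaces -/

/-- The closed unit square `[0,1]²`. -/
abbrev UnitSquare : Type := Set.Icc (0 : Fin 2 → ℝ) 1

/-- Side identifications of `N` unit squares: the right side of the square `s` is glued by a
translation to the left side of the square `right s`, and the top side of `s` to the bottom side
of the square `up s`. -/
inductive Glue {N : ℕ} (right up : Equiv.Perm (Fin N)) :
    Fin N × UnitSquare → Fin N × UnitSquare → Prop
  | horizontal (s : Fin N) (x y : UnitSquare) (hx : x.1 0 = 1) (hy : y.1 0 = 0)
      (hxy : x.1 1 = y.1 1) : Glue right up (s, x) (right s, y)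
  | vertical (s : Fin N) (x y : UnitSquare) (hx : x.1 1 = 1) (hy : y.1 1 = 0)
      (hxy : x.1 0 = y.1 0) : Glue right up (s, x) (up s, y)

/-- The closed surface obtained by gluing the squares. -/
def GluedSurface {N : ℕ} (right up : Equiv.Perm (Fin N)) : Type := Quot (Glue right up)

/-- The lower left corner of the square `s`, as a point of the surface. -/
def vertex {N : ℕ} (right up : Equiv.Perm (Fin N)) (s : Fin N) : GluedSurface right up :=
  Quot.mk _ (s, ⟨0, Set.left_mem_Icc.2 zero_le_one⟩)

/-- The integer `k` such that the total angle at a vertex `P` is `2πk`: every full turn around `P`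
meets exactly one square having `P` as its lower left corner. -/
def coneNumber {N : ℕ} (right up : Equiv.Perm (Fin N)) (P : GluedSurface right up) : ℕ :=
  {s : Fin N | vertex right up s = P}.ncard

/-- An origami (square-tiled surface): a connected surface tiled by finitely many unit squares,
with its finite set `sing` of conical singularities. The singularities are vertices of the tiling
(the covering of `ℝ²/ℤ²` is unramified outside `0`) and include every point whose angle exceeds
`2π`; singularities of angle `2π` (marked points) are allowed, as is needed for the torus. -/
structure Origami where
  numSquares : ℕ
  numSquares_pos : 0 < numSquares
  right : Equiv.Perm (Fin numSquares)
  up : Equiv.Perm (Fin numSquares)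
  connected : ∀ s s' : Fin numSquares, ∃ σ ∈ Subgroup.closure {right, up}, σ s = s'
  sing : Set (GluedSurface right up)
  sing_subset : sing ⊆ Set.range (vertex right up)
  mem_sing : ∀ P : GluedSurface right up, 2 ≤ coneNumber right up P → P ∈ sing

/-- The standard torus `ℝ²/ℤ²`, with the point `0` as its only singularity. -/
def torus : Origami where
  numSquares := 1
  numSquares_pos := Nat.one_pos
  right := 1
  up := 1
  connected := fun s s' => ⟨1, Subgroup.one_mem _, Subsingleton.elim _ _⟩
  sing := Set.range (vertex 1 1)
  sing_subset := subset_rfl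
  mem_sing := fun P hP => by
    by_contra h
    have he : {s : Fin 1 | vertex 1 1 s = P} = ∅ :=
      Set.eq_empty_iff_forall_notMem.2 fun s hs => h ⟨s, hs⟩
    simp [coneNumber, he] at hP

/-! ### Translation surfaces in the linear orbits of origamis -/

/-- The translation surface `frame · tiling`: the same surface as the origami `tiling`, whose flat
coordinates (the charts) are those of the unit squares composed with the linear map `frame`. -/
structure FlatSurface where
  tiling : Origami
  frame : GL (Fin 2) ℝ

/-- An origami as a translation surface tiled by unit squares. -/
def Origami.flat (S : Origami) : FlatSurface := ⟨S, 1⟩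

/-- The linear action on translation surfaces, by composition of the flat coordinates with `G`. -/
instance : MulAction (GL (Fin 2) ℝ) FlatSurface where
  smul G X := ⟨X.tiling, G * X.frame⟩
  one_smul X := congrArg (FlatSurface.mk X.tiling) (one_mul X.frame)
  mul_smul G H X := congrArg (FlatSurface.mk X.tiling) (mul_assoc G H X.frame)

/-- `γ`, restricted to `[0,1]`, is a saddle connection of `X` with period `w`: a path between two
singularities with no singularity in its interior, which before and after each time is, in the
flat coordinates of some closed tile, a straight segment run with constant velocity `w`. -/
structure IsSaddleConnection (X : FlatSurface) (w : Fin 2 → ℝ)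
    (γ : ℝ → GluedSurface X.tiling.right X.tiling.up) : Prop where
  velocity_ne : w ≠ 0
  start_mem : γ 0 ∈ X.tiling.sing
  end_mem : γ 1 ∈ X.tiling.sing
  interior_notMem : ∀ t ∈ Set.Ioo (0 : ℝ) 1, γ t ∉ X.tiling.sing
  forward : ∀ t ∈ Set.Ico (0 : ℝ) 1, ∃ (s : Fin X.tiling.numSquares) (x : UnitSquare),
    ∃ ε > 0, ∀ τ ∈ Set.Icc (0 : ℝ) ε, ∃ y : UnitSquare,
      X.frame.1.mulVec y.1 = X.frame.1.mulVec x.1 + τ • w ∧ γ (t + τ) = Quot.mk _ (s, y)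
  backward : ∀ t ∈ Set.Ioc (0 : ℝ) 1, ∃ (s : Fin X.tiling.numSquares) (x : UnitSquare),
    ∃ ε > 0, ∀ τ ∈ Set.Icc (0 : ℝ) ε, ∃ y : UnitSquare,
      X.frame.1.mulVec y.1 = X.frame.1.mulVec x.1 - τ • w ∧ γ (t - τ) = Quot.mk _ (s, y)

/-- The set of periods `Hol(X) ⊆ ℝ² = ℂ`. -/
def FlatSurface.hol (X : FlatSurface) : Set (Fin 2 → ℝ) :=
  {w | ∃ γ, IsSaddleConnection X w γ}

/-- An origami is reduced (primitive) if its periods generate `ℤ²`. -/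
def Origami.IsReduced (S : Origami) : Prop :=
  (AddSubgroup.closure S.flat.hol : Set (Fin 2 → ℝ)) =
    Set.range fun (z : Fin 2 → ℤ) (k : Fin 2) => (z k : ℝ)

/-! ### The Lagrange constant -/

/-- `L(X) = limsup 1 / (|Re w| |Im w|)` over the periods `w` of `X` with `|Im w| → ∞`, for a
translation surface `X` of area one. The value may be `∞`. -/
def lagrange (X : FlatSurface) : ℝ≥0∞ :=
  limsup (fun w : Fin 2 → ℝ => (ENNReal.ofReal (|w 0| * |w 1|))⁻¹)
    (comap (fun w : Fin 2 → ℝ => |w 1|) atTop ⊓ 𝓟 X.hol)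

/-- The rotation `r_θ`. -/
def rotationGL (θ : ℝ) : GL (Fin 2) ℝ :=
  Matrix.GeneralLinearGroup.mkOfDetNeZero
    !![Real.cos θ, -Real.sin θ; Real.sin θ, Real.cos θ] (by
      rw [Matrix.det_fin_two_of]
      nlinarith [Real.sin_sq_add_cos_sq θ])

/-- The homothety of ratio `1 / √N`, which rescales a surface tiled by `N` unit squares to
area one. -/
def Origami.rescale (S : Origami) : GL (Fin 2) ℝ :=
  Matrix.GeneralLinearGroup.mkOfDetNeZero
    !![(√(S.numSquares : ℝ))⁻¹, 0; 0, (√(S.numSquares : ℝ))⁻¹] (by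
      have h : (0 : ℝ) < S.numSquares := Nat.cast_pos.2 S.numSquares_pos
      rw [Matrix.det_fin_two_of]
      have := Real.sqrt_pos.2 h
      simp [this.ne'])

/-- `L(S, α) = L(r_{arctan α} · S)`, where `S` is normalized to have area one. -/
def lagrangeAt (S : Origami) (α : ℝ) : ℝ≥0∞ :=
  lagrange (rotationGL (Real.arctan α) • S.rescale • S.flat)

/-! ### Multiplicities -/

/-- The degree of the closed curve `t ↦ t w mod ℤ²`, `t ∈ [0,1)`, of the torus (for a nonzero
integer vector `w`) onto its image: the number of its passages through the origin. For a saddle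
connection of period `w` of a square-tiled surface this curve is its projection to the torus. -/
def degree (w : Fin 2 → ℝ) : ℕ :=
  {t : ℝ | t ∈ Set.Ico (0 : ℝ) 1 ∧ ∃ z : Fin 2 → ℤ, ∀ k, t * w k = z k}.ncard

/-- `m(p/q; X)`: the least multiplicity among the saddle connections of `X` parallel to the vector
`(p, q)`, that is of co-slope `p/q`; the co-slope `∞` is given by `(p, q) = (1, 0)`. -/
def slopeMultiplicity (p q : ℤ) (X : FlatSurface) : ℕ∞ :=
  ⨅ w ∈ {w ∈ X.hol | w 0 * q - w 1 * p = 0}, (degree w : ℕ∞)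

/-- `M_S`, the maximum of `m(p/q; S)` over all rational `p/q`. -/
def Origami.maxMultiplicity (S : Origami) : ℕ∞ :=
  ⨆ r : ℚ, slopeMultiplicity r.num r.den S.flat

/-! ### Continued fractions -/

/-- `[a₁, …, aₙ] = 1 / (a₁ + 1 / (a₂ + ⋯ + 1 / aₙ))`. -/
def cfFinite : List ℕ → ℝ
  | [] => 0
  | b :: l => 1 / (b + cfFinite l)

/-- `[b 0, b 1, …]`, for a sequence of positive integers. -/
def cfInfinite (b : ℕ → ℕ) : ℝ :=
  limUnder atTop fun k => cfFinite ((List.range k).map b)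

/-- `α = [a₁, a₂, …]` with positive integers `aₙ = a n` for `n ≥ 1` (the value `a 0` is unused). -/
def HasContinuedFraction (α : ℝ) (a : ℕ → ℕ) : Prop :=
  (∀ n, 1 ≤ n → 0 < a n) ∧
    Tendsto (fun n => cfFinite ((List.range' 1 n).map a)) atTop (𝓝 α)

/-- The finite sequence `a₁, …, a_{n-1}, i`. -/
def cfWord (a : ℕ → ℕ) (n i : ℕ) : List ℕ := (List.range' 1 (n - 1)).map a ++ [i]

/-- The quantity `D(n, i, α)` for `α = [a₁, a₂, …]` and `1 ≤ i ≤ aₙ`: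
`[aₙ, …, a₁] + a_{n+1} + [a_{n+2}, a_{n+3}, …]` if `i = aₙ`, and
`[i, a_{n-1}, …, a₁] + [aₙ - i, a_{n+1}, a_{n+2}, …]` if `i < aₙ`. -/
def cfD (a : ℕ → ℕ) (n i : ℕ) : ℝ :=
  if i = a n then
    cfFinite (cfWord a n (a n)).reverse + a (n + 1) + cfInfinite fun k => a (n + 2 + k)
  else
    cfFinite (cfWord a n i).reverse +
      cfInfinite fun k => if k = 0 then a n - i else a (n + k)

/-- The product `⋯ (T^{ε a₃} R) (T^{-ε a₂} R) (T^{ε a₁} R)`, with `T = (1 1; 0 1)` and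
`R = (0 -1; 1 0)`; the latter is called `S` in Mathlib. -/
def gSigned (ε : ℤ) : List ℕ → SL(2, ℤ)
  | [] => 1
  | b :: l => gSigned (-ε) l * (ModularGroup.T ^ (ε * b) * ModularGroup.S)

/-- `g(a₁, …, aₙ) = (T^{±aₙ} R) ⋯ (T^{a₃} R) (T^{-a₂} R) (T^{a₁} R)`, the sign of the exponent
of the `k`-th factor being `+` for odd `k` and `-` for even `k`. -/
def gMatrix (l : List ℕ) : SL(2, ℤ) := gSigned 1 l

/-- The action of an integer matrix of determinant one on an origami. -/
def Origami.act (A : SL(2, ℤ)) (S : Origami) : FlatSurface :=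
  Matrix.SpecialLinearGroup.mapGL ℝ A • S.flat

end

/-! ### Periods -/

/-! Write `areaAt α w` for `|w 1| * |w 0 - α * w 1|`. On the surface defining `L(S, α)`, the product
`|Re| |Im|` of a period is `areaAt α w / N_S` up to an error that vanishes at infinity, so `L(S, α)
/ N_S` is the limsup of `1 / areaAt α w` over the periods `w` of `S` (`lagrangeAt_le`,
`le_lagrangeAt`). A non-horizontal period is `m (p, q)` with `(p, q)` primitive; its multiplicity is
`|m|` and its area is `m²` times that of `(p, q)`.

Let `V_n` be the vector of the `n`-th convergent, with `V_0 = (1, 0)`. A primitive vector close to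
the line of co-slope `α` is `b V_n + c V_{n+1}` with `0 < b` and `0 < c ≤ a_{n+1} b`
(`exists_combination`). If `b = 1`, it is an intermediate convergent: its area is `1 / D(n+1, c, α)`
(`areaAt_mul_cfD`), and `R g(a₁, …, aₙ, c)` sends it to `±(1, 0)`, so the least multiplicity in its
direction is the one in the formula (`slopeMultiplicity_act_gMatrix`). The terms of the formula are
thus realized by periods, which gives the lower bound. If `b ≥ 2`, the area is at least `1 + 2/Λ`,
where `Λ` eventually bounds `D(n, a_n, α)` (`le_areaAt_of_two_le`).

For the upper bound, let `c` exceed the limsup on the right. Multiplicities are at most `M = M_S`,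
so eventually `D ≤ c M²`, and `Λ = c M²` is allowed. The same analysis on the torus gives `L(𝕋², α)
≤ c M²`. The hypothesis then yields `M² < c M² + 2`, that is `1 / (1 + 2/Λ) < c`: the vectors with
`b ≥ 2` contribute less than `c` as well. -/

theorem IsSaddleConnection.smul {X : FlatSurface} {w : Fin 2 → ℝ}
    {γ : ℝ → GluedSurface X.tiling.right X.tiling.up} (h : IsSaddleConnection X w γ)
    (G : GL (Fin 2) ℝ) : IsSaddleConnection (G • X) (G.1.mulVec w) γ := by
  have hfr : (G • X).frame.1 = G.1 * X.frame.1 := rfl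
  refine ⟨?_, h.start_mem, h.end_mem, h.interior_notMem, ?_, ?_⟩
  · intro h0
    apply h.velocity_ne
    have := congrArg (G⁻¹).1.mulVec h0
    rwa [Matrix.mulVec_mulVec, ← Units.val_mul, inv_mul_cancel, Units.val_one, Matrix.one_mulVec,
      Matrix.mulVec_zero] at this
  · intro t ht
    obtain ⟨s, x, ε, hε, H⟩ := h.forward t ht
    refine ⟨s, x, ε, hε, fun τ hτ => ?_⟩
    obtain ⟨y, hy, hγ⟩ := H τ hτ
    refine ⟨y, ?_, hγ⟩
    rw [hfr, ← Matrix.mulVec_mulVec, hy, Matrix.mulVec_add, Matrix.mulVec_smul,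
      Matrix.mulVec_mulVec]
  · intro t ht
    obtain ⟨s, x, ε, hε, H⟩ := h.backward t ht
    refine ⟨s, x, ε, hε, fun τ hτ => ?_⟩
    obtain ⟨y, hy, hγ⟩ := H τ hτ
    refine ⟨y, ?_, hγ⟩
    rw [hfr, ← Matrix.mulVec_mulVec, hy, Matrix.mulVec_sub, Matrix.mulVec_smul,
      Matrix.mulVec_mulVec]

theorem FlatSurface.hol_smul (G : GL (Fin 2) ℝ) (X : FlatSurface) :
    (G • X).hol = G.1.mulVec '' X.hol := by
  ext w
  constructor
  · rintro ⟨γ, h⟩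
    refine ⟨(G⁻¹).1.mulVec w, ?_, ?_⟩
    · have := h.smul G⁻¹
      have hX : G⁻¹ • G • X = X := inv_smul_smul G X
      have h2 : (G⁻¹).1.mulVec w ∈ (G⁻¹ • G • X).hol := ⟨γ, this⟩
      rwa [hX] at h2
    · rw [Matrix.mulVec_mulVec, ← Units.val_mul, mul_inv_cancel, Units.val_one,
        Matrix.one_mulVec]
  · rintro ⟨v, ⟨γ, h⟩, rfl⟩
    exact ⟨γ, h.smul G⟩

/-- The projection of a square-tiled surface to the torus `ℝ²/ℤ²`. -/
noncomputable def torusProj {N : ℕ} (right up : Equiv.Perm (Fin N)) (k : Fin 2) :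
    GluedSurface right up → AddCircle (1 : ℝ) :=
  Quot.lift (fun p => ((p.2.1 k : ℝ) : AddCircle (1 : ℝ))) (by
    have h1 : ((1 : ℝ) : AddCircle (1 : ℝ)) = ((0 : ℝ) : AddCircle (1 : ℝ)) := by
      simp
    rintro _ _ (⟨s, x, y, hx, hy, hxy⟩ | ⟨s, x, y, hx, hy, hxy⟩) <;> fin_cases k <;>
      simp_all)

/-- Modulo 1, the `k`-th coordinate of `γ t` minus `t * w k` is locally constant on `[0,1]`, hence
constant. Singularities are vertices and project to `0`, so comparing the two ends gives `w k ∈ ℤ`.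
-/
theorem Origami.exists_int_of_mem_hol (S : Origami) {w : Fin 2 → ℝ} (hw : w ∈ S.flat.hol) :
    ∃ z : Fin 2 → ℤ, w = fun k => (z k : ℝ) := by
  obtain ⟨γ, h⟩ := hw
  suffices H : ∀ k, ∃ z : ℤ, w k = z by
    choose z hz using H
    exact ⟨z, funext hz⟩
  intro k
  have hF : S.flat.frame.1 = 1 := rfl
  let f : Set.Icc (0 : ℝ) 1 → AddCircle (1 : ℝ) := fun t =>
    torusProj S.right S.up k (γ t.1) - ((t.1 * w k : ℝ) : AddCircle (1 : ℝ))
  have hf : IsLocallyConstant f := by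
    rw [IsLocallyConstant.iff_eventually_eq]
    rintro ⟨t, ht⟩
    have hr : ∃ ε > 0, ∀ t' : Set.Icc (0 : ℝ) 1, t ≤ t'.1 → t'.1 ≤ t + ε → f t' = f ⟨t, ht⟩ := by
      rcases ht.2.lt_or_eq with h1 | h1
      · obtain ⟨s, x, ε, hε, H⟩ := h.forward t ⟨ht.1, h1⟩
        have key : ∀ τ ∈ Set.Icc 0 ε, torusProj S.right S.up k (γ (t + τ)) =
            ((x.1 k + τ * w k : ℝ) : AddCircle (1 : ℝ)) := by
          intro τ hτ
          obtain ⟨y, hy, hγ⟩ := H τ hτ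
          rw [hF, Matrix.one_mulVec, Matrix.one_mulVec] at hy
          rw [hγ]
          change ((y.1 k : ℝ) : AddCircle (1 : ℝ)) = _
          rw [hy]; rfl
        refine ⟨ε, hε, fun t' h2 h3 => ?_⟩
        have e1 := key (t' - t) ⟨by linarith, by linarith⟩
        have e2 := key 0 ⟨le_rfl, hε.le⟩
        rw [add_sub_cancel] at e1
        rw [add_zero] at e2
        simp only [f, e1, e2, ← AddCircle.coe_sub]
        congr 1; ring
      · refine ⟨1, one_pos, fun t' h2 _ => ?_⟩
        congr 1
        exact Subtype.ext (le_antisymm (h1 ▸ t'.2.2) h2)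
    have hl : ∃ ε > 0, ∀ t' : Set.Icc (0 : ℝ) 1, t'.1 ≤ t → t - ε ≤ t'.1 → f t' = f ⟨t, ht⟩ := by
      rcases ht.1.lt_or_eq with h1 | h1
      · obtain ⟨s, x, ε, hε, H⟩ := h.backward t ⟨h1, ht.2⟩
        have key : ∀ τ ∈ Set.Icc 0 ε, torusProj S.right S.up k (γ (t - τ)) =
            ((x.1 k - τ * w k : ℝ) : AddCircle (1 : ℝ)) := by
          intro τ hτ
          obtain ⟨y, hy, hγ⟩ := H τ hτ
          rw [hF, Matrix.one_mulVec, Matrix.one_mulVec] at hy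
          rw [hγ]
          change ((y.1 k : ℝ) : AddCircle (1 : ℝ)) = _
          rw [hy]; rfl
        refine ⟨ε, hε, fun t' h2 h3 => ?_⟩
        have e1 := key (t - t') ⟨by linarith, by linarith⟩
        have e2 := key 0 ⟨le_rfl, hε.le⟩
        rw [sub_sub_cancel] at e1
        rw [sub_zero] at e2
        simp only [f, e1, e2, ← AddCircle.coe_sub]
        congr 1; ring
      · refine ⟨1, one_pos, fun t' h2 _ => ?_⟩
        congr 1
        exact Subtype.ext (le_antisymm h2 (h1 ▸ t'.2.1))
    obtain ⟨ε, hε, h1⟩ := hr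
    obtain ⟨ε', hε', h2⟩ := hl
    have hmem : {t' : Set.Icc (0 : ℝ) 1 | t'.1 ∈ Set.Ioo (t - ε') (t + ε)} ∈
        𝓝 (⟨t, ht⟩ : Set.Icc (0 : ℝ) 1) :=
      (isOpen_Ioo.preimage continuous_subtype_val).mem_nhds
        (show t ∈ Set.Ioo (t - ε') (t + ε) from ⟨by linarith, by linarith⟩)
    filter_upwards [hmem] with t' ht'
    rcases le_total t t'.1 with h3 | h3
    · exact h1 t' h3 ht'.2.le
    · exact h2 t' h3 ht'.1.le
  have h01 := hf.apply_eq_of_preconnectedSpace ⟨0, by simp⟩ ⟨1, by simp⟩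
  have hs : ∀ P ∈ S.sing, torusProj S.right S.up k P = 0 := by
    intro P hP
    obtain ⟨s, rfl⟩ := S.sing_subset hP
    change (((0 : Fin 2 → ℝ) k : ℝ) : AddCircle (1 : ℝ)) = 0
    simp
  simp only [f] at h01
  rw [hs _ h.start_mem, hs _ h.end_mem] at h01
  have h0 : ((w k : ℝ) : AddCircle (1 : ℝ)) = 0 := by simpa using h01.symm
  obtain ⟨n, hn⟩ := (AddCircle.coe_eq_zero_iff (1 : ℝ)).1 h0
  exact ⟨n, by simpa using hn.symm⟩

theorem FlatSurface.ne_zero_of_mem_hol {X : FlatSurface} {w : Fin 2 → ℝ} (hw : w ∈ X.hol) :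
    w ≠ 0 := by
  obtain ⟨γ, h⟩ := hw
  exact h.velocity_ne

/-- Every period of an origami is a nonzero multiple of a primitive integer vector. -/
theorem Origami.exists_primitive_of_mem_hol (S : Origami) {w : Fin 2 → ℝ} (hw : w ∈ S.flat.hol)
    (h1 : w 1 ≠ 0) : ∃ m p q : ℤ, m ≠ 0 ∧ 0 < q ∧ IsCoprime p q ∧ w 0 = m * p ∧ w 1 = m * q := by
  obtain ⟨z, rfl⟩ := S.exists_int_of_mem_hol hw
  have hz : z 1 ≠ 0 := fun h => h1 (by simp [h])
  have hg : 0 < Int.gcd (z 0) (z 1) := Int.gcd_pos_of_ne_zero_right _ hz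
  obtain ⟨p, q, hpq, hp, hq⟩ := Int.exists_gcd_one hg
  have hq0 : q ≠ 0 := by rintro rfl; simp at hq; exact hz hq
  rcases hq0.lt_or_gt with hn | hn
  · refine ⟨-(Int.gcd (z 0) (z 1)), -p, -q, by omega, by omega,
      (Int.isCoprime_iff_gcd_eq_one.2 hpq).neg_neg, ?_, ?_⟩
    · have : z 0 = -(Int.gcd (z 0) (z 1)) * -p := by linarith
      change ((z 0 : ℤ) : ℝ) = _
      exact_mod_cast this
    · have : z 1 = -(Int.gcd (z 0) (z 1)) * -q := by linarith
      change ((z 1 : ℤ) : ℝ) = _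
      exact_mod_cast this
  · refine ⟨Int.gcd (z 0) (z 1), p, q, by omega, hn, Int.isCoprime_iff_gcd_eq_one.2 hpq, ?_, ?_⟩
    · have : z 0 = (Int.gcd (z 0) (z 1)) * p := by linarith
      change ((z 0 : ℤ) : ℝ) = _
      exact_mod_cast this
    · have : z 1 = (Int.gcd (z 0) (z 1)) * q := by linarith
      change ((z 1 : ℤ) : ℝ) = _
      exact_mod_cast this

/-! ### Multiplicities -/

/-- By a Bézout relation, `t m p` and `t m q` are both integers only if `t m` is, so the passages
through the origin are the times `k / |m|`. -/
theorem degree_smul_primitive {w : Fin 2 → ℝ} {m p q : ℤ} (hm : m ≠ 0) (hpq : IsCoprime p q)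
    (h0 : w 0 = m * p) (h1 : w 1 = m * q) : degree w = m.natAbs := by
  have hM : (0 : ℝ) < m.natAbs := by exact_mod_cast Int.natAbs_pos.2 hm
  have hMm : ((m.natAbs : ℕ) : ℝ) = |(m : ℝ)| := by rw [Nat.cast_natAbs, Int.cast_abs]
  have hset : {t : ℝ | t ∈ Set.Ico (0 : ℝ) 1 ∧ ∃ z : Fin 2 → ℤ, ∀ k, t * w k = z k} =
      (fun k : ℕ => (k : ℝ) / m.natAbs) '' (Finset.range m.natAbs : Set ℕ) := by
    ext t
    constructor
    · rintro ⟨⟨ht0, ht1⟩, z, hz⟩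
      obtain ⟨u, v, huv⟩ := hpq
      have hk : t * m = ((u * z 0 + v * z 1 : ℤ) : ℝ) := by
        have huv' : (u : ℝ) * p + v * q = 1 := by exact_mod_cast huv
        have e0 := hz 0
        have e1 := hz 1
        rw [h0] at e0
        rw [h1] at e1
        push_cast
        rw [← e0, ← e1]
        linear_combination (-t * m) * huv'
      generalize u * z 0 + v * z 1 = k at hk
      have hk2 : t * m.natAbs = (k.natAbs : ℝ) := by
        rw [hMm, Nat.cast_natAbs, Int.cast_abs, ← hk, abs_mul, abs_of_nonneg ht0]
      refine ⟨k.natAbs, ?_, ?_⟩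
      · rw [Finset.mem_coe, Finset.mem_range]
        have : (k.natAbs : ℝ) < m.natAbs := by rw [← hk2]; nlinarith
        exact_mod_cast this
      · simp only
        rw [← hk2]; field_simp
    · rintro ⟨k, hk, rfl⟩
      rw [Finset.mem_coe, Finset.mem_range] at hk
      have hk' : (k : ℝ) < m.natAbs := by exact_mod_cast hk
      refine ⟨⟨by positivity, by simp only; rwa [div_lt_one hM]⟩, ?_⟩
      obtain ⟨s, hs⟩ : ∃ s : ℤ, (m : ℝ) = s * (m.natAbs : ℝ) :=
        ⟨m.sign, by rw [← Int.cast_natCast, ← Int.cast_mul, Int.sign_mul_natAbs]⟩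
      refine ⟨![k * s * p, k * s * q], fun j => ?_⟩
      fin_cases j
      · simp only [Fin.zero_eta, h0, Matrix.cons_val_zero]
        rw [hs]; push_cast; field_simp
      · simp only [Fin.mk_one, h1, Matrix.cons_val_one, Matrix.cons_val_zero]
        rw [hs]; push_cast; field_simp
  rw [degree, hset, Set.ncard_image_of_injective]
  · simp
  · intro x y hxy
    simp only at hxy
    field_simp at hxy
    exact_mod_cast hxy

theorem degree_specialLinear_mulVec (A : SL(2, ℤ)) (w : Fin 2 → ℝ) :
    degree ((Matrix.SpecialLinearGroup.mapGL ℝ A).1.mulVec w) = degree w := by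
  have key : ∀ (A : SL(2, ℤ)) (w : Fin 2 → ℝ) (t : ℝ), (∃ z : Fin 2 → ℤ, ∀ k, t * w k = z k) →
      ∃ z : Fin 2 → ℤ, ∀ k, t * ((Matrix.SpecialLinearGroup.mapGL ℝ A).1.mulVec w) k = z k := by
    rintro A w t ⟨z, hz⟩
    refine ⟨A.1.mulVec z, fun k => ?_⟩
    simp only [Matrix.mulVec, dotProduct, Fin.sum_univ_two]
    push_cast
    rw [← hz 0, ← hz 1]
    simp
    ring
  unfold degree
  congr 1
  ext t
  refine and_congr_right fun _ => ⟨fun h => ?_, key A w t⟩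
  have := key A⁻¹ _ t h
  rwa [Matrix.mulVec_mulVec, ← Units.val_mul, ← map_mul, inv_mul_cancel, map_one, Units.val_one,
    Matrix.one_mulVec] at this

/-- If `A (p, q) = ± (1, 0)`, then `A` carries saddle connections of co-slope `p/q` to horizontal
ones and preserves their multiplicities. -/
theorem slopeMultiplicity_act (S : Origami) (A : SL(2, ℤ)) (p q : ℤ)
    (h : A.1.mulVec ![p, q] = ![1, 0] ∨ A.1.mulVec ![p, q] = ![-1, 0]) :
    slopeMultiplicity 1 0 (S.act A) = slopeMultiplicity p q S.flat := by
  obtain ⟨r, hr, h⟩ : ∃ r : ℤ, (r = 1 ∨ r = -1) ∧ A.1 0 0 * p + A.1 0 1 * q = r ∧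
      A.1 1 0 * p + A.1 1 1 * q = 0 := by
    rcases h with h | h
    · have h0 := congrFun h 0
      have h1 := congrFun h 1
      simp [Matrix.mulVec, dotProduct, Fin.sum_univ_two] at h0 h1
      exact ⟨1, Or.inl rfl, h0, h1⟩
    · have h0 := congrFun h 0
      have h1 := congrFun h 1
      simp [Matrix.mulVec, dotProduct, Fin.sum_univ_two] at h0 h1
      exact ⟨-1, Or.inr rfl, h0, h1⟩
  have hdet : A.1 0 0 * A.1 1 1 - A.1 0 1 * A.1 1 0 = 1 := by
    rw [← Matrix.det_fin_two]; exact A.2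
  have hr2 : r * r = 1 := by rcases hr with rfl | rfl <;> rfl
  -- Determinant one forces the bottom row of `A` to be `±(-q, p)`: the second coordinate of `A w`
  -- is, up to sign, the cross product of `w` with `(p, q)`.
  have e0 : A.1 1 0 = -(r * q) := by
    linear_combination (-A.1 1 0) * hr2 - r * A.1 1 0 * h.1 + r * A.1 0 0 * h.2 - r * q * hdet
  have e1 : A.1 1 1 = r * p := by
    linear_combination (-A.1 1 1) * hr2 - r * A.1 1 1 * h.1 + r * A.1 0 1 * h.2 + r * p * hdet
  have hpar : ∀ w : Fin 2 → ℝ, ((Matrix.SpecialLinearGroup.mapGL ℝ A).1.mulVec w) 1 = 0 ↔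
      w 0 * q - w 1 * p = 0 := by
    intro w
    have : ((Matrix.SpecialLinearGroup.mapGL ℝ A).1.mulVec w) 1 =
        (A.1 1 0 : ℝ) * w 0 + (A.1 1 1 : ℝ) * w 1 := by
      simp [Matrix.mulVec, dotProduct, Fin.sum_univ_two]
    rw [this, e0, e1]
    rcases hr with rfl | rfl <;> push_cast <;> constructor <;> intro h <;> linarith
  unfold slopeMultiplicity Origami.act
  rw [FlatSurface.hol_smul]
  apply le_antisymm
  · refine le_iInf₂ fun w hw => ?_
    refine iInf₂_le_of_le ((Matrix.SpecialLinearGroup.mapGL ℝ A).1.mulVec w)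
      ⟨⟨w, hw.1, rfl⟩, ?_⟩ ?_
    · rw [(hpar w).2 hw.2]
      simp
    · rw [degree_specialLinear_mulVec]
  · refine le_iInf₂ fun w hw => ?_
    obtain ⟨⟨v, hv, rfl⟩, h2⟩ := hw
    refine iInf₂_le_of_le v ⟨hv, (hpar v).1 ?_⟩ ?_
    · push_cast at h2
      linarith
    · rw [degree_specialLinear_mulVec]

theorem slopeMultiplicity_le_max (S : Origami) {p q : ℤ} (hq : 0 < q) (hpq : IsCoprime p q) :
    slopeMultiplicity p q S.flat ≤ S.maxMultiplicity := by
  have hc : Nat.Coprime p.natAbs q.natAbs := Int.isCoprime_iff_nat_coprime.1 hpq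
  have h1 := Rat.num_div_eq_of_coprime hq hc
  have h2 := Rat.den_div_eq_of_coprime hq hc
  have := le_iSup (fun r : ℚ => slopeMultiplicity r.num r.den S.flat) ((p : ℚ) / q)
  simp only [h1, h2] at this
  exact this

theorem exists_degree_eq_slopeMultiplicity (S : Origami) {p q : ℤ}
    (h : slopeMultiplicity p q S.flat ≠ ⊤) :
    ∃ w ∈ S.flat.hol, w 0 * q - w 1 * p = 0 ∧ slopeMultiplicity p q S.flat = degree w := by
  have hs : slopeMultiplicity p q S.flat =
      sInf ((fun w => (degree w : ℕ∞)) '' {w ∈ S.flat.hol | w 0 * q - w 1 * p = 0}) := by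
    rw [sInf_image, slopeMultiplicity]
  have hne : ((fun w => (degree w : ℕ∞)) ''
      {w ∈ S.flat.hol | w 0 * q - w 1 * p = 0}).Nonempty := by
    by_contra hcon
    rw [Set.not_nonempty_iff_eq_empty] at hcon
    rw [hs, hcon, sInf_empty] at h
    exact h rfl
  obtain ⟨w, hw, hw2⟩ := csInf_mem hne
  exact ⟨w, hw.1, hw.2, by rw [hs, ← hw2]⟩

theorem slopeMultiplicity_le_degree (S : Origami) {p q : ℤ} {w : Fin 2 → ℝ}
    (hw : w ∈ S.flat.hol) (h : w 0 * q - w 1 * p = 0) :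
    slopeMultiplicity p q S.flat ≤ degree w :=
  iInf₂_le (f := fun w _ => (degree w : ℕ∞)) w ⟨hw, h⟩

/-! ### The Lagrange constant through the tiling coordinates -/

/-- The quantity `|y| |x - α y|` for `w = (x, y)`. -/
noncomputable def areaAt (α : ℝ) (w : Fin 2 → ℝ) : ℝ := |w 1| * |w 0 - α * w 1|

/-- The linear map that carries `S` to the surface defining `L(S, α)`. -/
theorem lagrangeAt_frame_mulVec (S : Origami) (α : ℝ) (w : Fin 2 → ℝ) :
    ((rotationGL (Real.arctan α) * S.rescale).1.mulVec w) =
      ![(√(S.numSquares : ℝ))⁻¹ * (√(1 + α ^ 2))⁻¹ * (w 0 - α * w 1),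
        (√(S.numSquares : ℝ))⁻¹ * (√(1 + α ^ 2))⁻¹ * (α * w 0 + w 1)] := by
  have h1 : (rotationGL (Real.arctan α)).1 = !![Real.cos (Real.arctan α),
    -Real.sin (Real.arctan α); Real.sin (Real.arctan α), Real.cos (Real.arctan α)] := rfl
  have h2 : S.rescale.1 = !![(√(S.numSquares : ℝ))⁻¹, 0; 0, (√(S.numSquares : ℝ))⁻¹] := rfl
  rw [Units.val_mul, h1, h2, Real.cos_arctan, Real.sin_arctan]
  ext k
  fin_cases k <;> simp [Matrix.mulVec, dotProduct, Fin.sum_univ_two] <;> ring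

/-- Rotation and rescaling multiply both linear forms by the same constant `c > 0` with `c² = 1 / (N
(1 + α²))`; such a factor does not affect the condition that the height tends to infinity. -/
theorem lagrangeAt_eq (S : Origami) (α : ℝ) :
    lagrangeAt S α = limsup (fun w : Fin 2 → ℝ => (S.numSquares : ℝ≥0∞) *
        (ENNReal.ofReal (|w 0 - α * w 1| * |α * w 0 + w 1| / (1 + α ^ 2)))⁻¹)
      (comap (fun w : Fin 2 → ℝ => |α * w 0 + w 1|) atTop ⊓ 𝓟 S.flat.hol) := by
  have hN : (0 : ℝ) < S.numSquares := Nat.cast_pos.2 S.numSquares_pos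
  have hα : 0 < 1 + α ^ 2 := by positivity
  set c := (√(S.numSquares : ℝ))⁻¹ * (√(1 + α ^ 2))⁻¹ with hc
  have hc0 : 0 < c := by have := Real.sqrt_pos.2 hN; have := Real.sqrt_pos.2 hα; positivity
  have hcc : c * c = (S.numSquares : ℝ)⁻¹ * (1 + α ^ 2)⁻¹ := by
    rw [hc, mul_mul_mul_comm, ← mul_inv, ← mul_inv, Real.mul_self_sqrt hN.le,
      Real.mul_self_sqrt hα.le]
  set G := rotationGL (Real.arctan α) * S.rescale with hG
  have hGw : ∀ w, G.1.mulVec w = ![c * (w 0 - α * w 1), c * (α * w 0 + w 1)] :=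
    lagrangeAt_frame_mulVec S α
  have hfilter : comap (fun w : Fin 2 → ℝ => |w 1|) atTop ⊓ 𝓟 (G • S.flat).hol =
      map G.1.mulVec (comap (fun w : Fin 2 → ℝ => |α * w 0 + w 1|) atTop ⊓ 𝓟 S.flat.hol) := by
    have hcomap : comap (fun w : Fin 2 → ℝ => |α * w 0 + w 1|) atTop =
        comap G.1.mulVec (comap (fun w : Fin 2 → ℝ => |w 1|) atTop) := by
      rw [comap_comap]
      have : (fun w : Fin 2 → ℝ => |w 1|) ∘ G.1.mulVec =
          (fun r => c * r) ∘ fun w => |α * w 0 + w 1| := by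
        ext w
        simp [hGw, abs_mul, abs_of_pos hc0]
      rw [this, ← comap_comap]
      congr 1
      exact ((OrderIso.mulLeft₀ c hc0).comap_atTop).symm
    rw [hcomap, FlatSurface.hol_smul, Filter.push_pull', map_principal]
  unfold lagrangeAt
  rw [← mul_smul, ← hG, lagrange, hfilter, limsup, limsup, map_map]
  congr 2
  ext w
  simp only [Function.comp_apply, hGw, Matrix.cons_val_zero, Matrix.cons_val_one]
  have e : |c * (w 0 - α * w 1)| * |c * (α * w 0 + w 1)| =
      (S.numSquares : ℝ)⁻¹ * (|w 0 - α * w 1| * |α * w 0 + w 1| / (1 + α ^ 2)) := by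
    rw [abs_mul c, abs_mul c, abs_of_pos hc0]
    linear_combination |w 0 - α * w 1| * |α * w 0 + w 1| * hcc
  rw [e, ENNReal.ofReal_mul (by positivity), ENNReal.ofReal_inv_of_pos hN,
    ENNReal.ofReal_natCast, ENNReal.mul_inv, inv_inv]
  · left; simp
  · left; simpa using S.numSquares_pos.ne'

/-- With `d = w 0 - α * w 1`, the height `α * w 0 + w 1` equals `(1 + α²) (w 1 + α d / (1 + α²))`.
The error is harmless because `d → 0` when the area stays bounded and the height grows. -/
theorem abs_area_sub_le (α : ℝ) (w : Fin 2 → ℝ) :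
    |areaAt α w - |w 0 - α * w 1| * |α * w 0 + w 1| / (1 + α ^ 2)| ≤ |α| * |w 0 - α * w 1| ^ 2 := by
  have hα : 0 < 1 + α ^ 2 := by positivity
  have hα1 : 1 ≤ 1 + α ^ 2 := by nlinarith [sq_nonneg α]
  set d := w 0 - α * w 1 with hd
  have h1 : α * w 0 + w 1 = (1 + α ^ 2) * (w 1 + α / (1 + α ^ 2) * d) := by
    rw [hd]; field_simp; ring
  have h2 : areaAt α w - |d| * |α * w 0 + w 1| / (1 + α ^ 2) =
      |d| * (|w 1| - |w 1 + α / (1 + α ^ 2) * d|) := by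
    rw [h1, abs_mul, abs_of_pos hα, areaAt, ← hd]; field_simp
  have h3 : |(|w 1| - |w 1 + α / (1 + α ^ 2) * d|)| ≤ |α| * |d| := by
    refine (abs_abs_sub_abs_le_abs_sub _ _).trans ?_
    rw [sub_add_cancel_left, abs_neg, abs_mul, abs_div, abs_of_pos hα]
    gcongr
    exact div_le_self (abs_nonneg _) hα1
  rw [h2, abs_mul, abs_abs]
  calc _ ≤ |d| * (|α| * |d|) := by gcongr
    _ = _ := by ring

theorem lagrangeAt_le (S : Origami) (α : ℝ) {c : ℝ} (hc : 0 < c)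
    (h : ∀ c' > c, ∃ Y : ℝ, ∀ w ∈ S.flat.hol, Y ≤ |w 1| → 1 ≤ c' * areaAt α w) :
    lagrangeAt S α ≤ S.numSquares * ENNReal.ofReal c := by
  have hα : 0 < 1 + α ^ 2 := by positivity
  have hα1 : 1 ≤ 1 + α ^ 2 := by nlinarith [sq_nonneg α]
  suffices H : ∀ c'' > c, lagrangeAt S α ≤ S.numSquares * ENNReal.ofReal c'' by
    have ht : Tendsto (fun c'' : ℝ => (S.numSquares : ℝ≥0∞) * ENNReal.ofReal c'') (𝓝[>] c)
        (𝓝 (S.numSquares * ENNReal.ofReal c)) := by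
      refine ENNReal.Tendsto.const_mul ?_ (Or.inr (ENNReal.natCast_ne_top _))
      exact (ENNReal.continuous_ofReal.tendsto c).mono_left nhdsWithin_le_nhds
    exact ge_of_tendsto ht (eventually_nhdsWithin_of_forall fun c'' h => H c'' h)
  intro c'' hc''
  obtain ⟨c', hc1, hc2⟩ := exists_between hc''
  have hc'0 : 0 < c' := hc.trans hc1
  have hc''0 : 0 < c'' := hc'0.trans hc2
  obtain ⟨Y, hY⟩ := h c' hc1
  rw [lagrangeAt_eq]
  refine limsup_le_of_le (by isBoundedDefault) ?_
  have hgap : 0 < c'⁻¹ - c''⁻¹ := sub_pos.2 ((inv_lt_inv₀ hc''0 hc'0).2 hc2)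
  set C := (1 + α ^ 2) / c'' with hC
  have hC0 : 0 < C := by positivity
  -- For a period violating the bound `d t < C`; the three thresholds then give `d ≤ C`, `Y ≤ |w
  -- 1|`, and an error `|α| d²` below the gap `1/c' - 1/c''`.
  have hev : ∀ᶠ t : ℝ in atTop, 1 ≤ t ∧ Y * (1 + α ^ 2) + |α| * C ≤ t ∧
      |α| * C ^ 2 / (c'⁻¹ - c''⁻¹) ≤ t :=
    (eventually_ge_atTop _).and ((eventually_ge_atTop _).and (eventually_ge_atTop _))
  rw [eventually_inf_principal]
  filter_upwards [hev.comap (fun w : Fin 2 → ℝ => |α * w 0 + w 1|)] with w hw hhol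
  obtain ⟨ht1, ht2, ht3⟩ := hw
  set t := |α * w 0 + w 1| with ht
  set d := |w 0 - α * w 1| with hd
  have hd0 : 0 ≤ d := abs_nonneg _
  gcongr
  suffices HB : c''⁻¹ ≤ d * t / (1 + α ^ 2) by
    calc _ ≤ (ENNReal.ofReal c''⁻¹)⁻¹ := ENNReal.inv_le_inv.2 (ENNReal.ofReal_le_ofReal HB)
      _ = _ := by rw [ENNReal.ofReal_inv_of_pos hc''0, inv_inv]
  by_contra! hB
  have hdt : d * t < C := by
    rw [div_lt_iff₀ hα] at hB
    rw [hC]; calc _ < _ := hB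
      _ = _ := by field_simp
  have hdC : d ≤ C := by nlinarith
  have hy : Y ≤ |w 1| := by
    have h1 : (1 + α ^ 2) * w 1 = (α * w 0 + w 1) - α * (w 0 - α * w 1) := by ring
    have h2 : t - |α| * d ≤ (1 + α ^ 2) * |w 1| := by
      rw [← abs_of_pos hα, ← abs_mul (1 + α ^ 2), h1, ht, hd, ← abs_mul]
      exact abs_sub_abs_le_abs_sub _ _
    have h3 : |α| * d ≤ |α| * C := by gcongr
    nlinarith
  have hA := hY w hhol hy
  have hA' : c'⁻¹ ≤ areaAt α w := by
    rw [inv_le_iff_one_le_mul₀ hc'0]; linarith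
  have hdiff := (abs_le.1 (abs_area_sub_le α w)).2
  rw [← ht, ← hd] at hdiff
  have h4 : |α| * d ^ 2 < c'⁻¹ - c''⁻¹ := by
    rcases (abs_nonneg α).eq_or_lt with h0 | h0
    · rw [← h0]; simpa using hgap
    · rw [div_le_iff₀ hgap] at ht3
      have h5 : (d * t) ^ 2 < C ^ 2 := by
        apply pow_lt_pow_left₀ hdt (by positivity) (by norm_num)
      have h6 : |α| * d ^ 2 * t ≤ |α| * (d * t) ^ 2 := by
        have : d ^ 2 * t ≤ (d * t) ^ 2 := by nlinarith [sq_nonneg d]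
        rw [mul_assoc]; gcongr
      have h7 : |α| * (d * t) ^ 2 < |α| * C ^ 2 := by gcongr
      nlinarith
  linarith

theorem le_lagrangeAt (S : Origami) (α : ℝ) {c : ℝ} (hc : 0 < c)
    (h : ∀ Y : ℝ, ∃ w ∈ S.flat.hol, Y ≤ |w 1| ∧ c * areaAt α w ≤ 1) :
    S.numSquares * ENNReal.ofReal c ≤ lagrangeAt S α := by
  have hα : 0 < 1 + α ^ 2 := by positivity
  have hα1 : 1 ≤ 1 + α ^ 2 := by nlinarith [sq_nonneg α]
  suffices H : ∀ c'' < c, 0 < c'' → S.numSquares * ENNReal.ofReal c'' ≤ lagrangeAt S α by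
    have ht : Tendsto (fun c'' : ℝ => (S.numSquares : ℝ≥0∞) * ENNReal.ofReal c'') (𝓝[<] c)
        (𝓝 (S.numSquares * ENNReal.ofReal c)) := by
      refine ENNReal.Tendsto.const_mul ?_ (Or.inr (ENNReal.natCast_ne_top _))
      exact (ENNReal.continuous_ofReal.tendsto c).mono_left nhdsWithin_le_nhds
    refine le_of_tendsto ht ?_
    filter_upwards [self_mem_nhdsWithin, mem_nhdsWithin_of_mem_nhds (lt_mem_nhds hc)] with x h1 h2
      using H x h1 h2
  intro c' hc' hc'0
  have hgap : 0 < c'⁻¹ - c⁻¹ := sub_pos.2 ((inv_lt_inv₀ hc hc'0).2 hc')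
  rw [lagrangeAt_eq]
  refine le_limsup_of_frequently_le ?_ (by isBoundedDefault)
  rw [frequently_inf_principal]
  intro hcon
  rw [eventually_comap] at hcon
  obtain ⟨W, hW⟩ := eventually_atTop.1 hcon
  obtain ⟨w, hw, hy, hA⟩ := h (max 1 (max (W + |α| * c⁻¹) (|α| * c⁻¹ ^ 2 / (c'⁻¹ - c⁻¹))))
  simp only [max_le_iff] at hy
  obtain ⟨hy1, hy2, hy3⟩ := hy
  have hA' : areaAt α w ≤ c⁻¹ := by
    rw [← one_div, le_div_iff₀ hc]; linarith
  have hdiff := (abs_le.1 (abs_area_sub_le α w)).1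
  set d := |w 0 - α * w 1| with hd
  have hd0 : 0 ≤ d := abs_nonneg _
  have hyd : |w 1| * d ≤ c⁻¹ := hA'
  have hdC : d ≤ c⁻¹ := by nlinarith
  have ht : W ≤ |α * w 0 + w 1| := by
    have h1 : α * w 0 + w 1 = (1 + α ^ 2) * w 1 + α * (w 0 - α * w 1) := by ring
    have h2 : (1 + α ^ 2) * |w 1| - |α| * d ≤ |α * w 0 + w 1| := by
      rw [h1, hd, ← abs_mul α, ← abs_of_pos hα, ← abs_mul]
      have := abs_sub_abs_le_abs_add ((1 + α ^ 2) * w 1) (α * (w 0 - α * w 1))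
      rwa [abs_of_pos hα] at *
    have h3 : |α| * d ≤ |α| * c⁻¹ := by gcongr
    nlinarith
  refine hW _ ht w rfl ⟨hw, ?_⟩
  gcongr
  have h4 : |α| * d ^ 2 ≤ c'⁻¹ - c⁻¹ := by
    rw [div_le_iff₀ hgap] at hy3
    have h5 : (|w 1| * d) ^ 2 ≤ c⁻¹ ^ 2 := by
      apply pow_le_pow_left₀ (by positivity) hyd
    have h6 : |α| * d ^ 2 * |w 1| ≤ |α| * (|w 1| * d) ^ 2 := by
      have : d ^ 2 * |w 1| ≤ (|w 1| * d) ^ 2 := by nlinarith [sq_nonneg d]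
      rw [mul_assoc]; gcongr
    have h7 : |α| * (|w 1| * d) ^ 2 ≤ |α| * c⁻¹ ^ 2 := by gcongr
    nlinarith
  have HB : d * |α * w 0 + w 1| / (1 + α ^ 2) ≤ c'⁻¹ := by linarith
  calc ENNReal.ofReal c' = (ENNReal.ofReal c'⁻¹)⁻¹ := by
        rw [ENNReal.ofReal_inv_of_pos hc'0, inv_inv]
    _ ≤ _ := ENNReal.inv_le_inv.2 (ENNReal.ofReal_le_ofReal HB)

/-! ### Complete quotients -/

theorem cfFinite_mem_Icc {l : List ℕ} (hl : ∀ b ∈ l, 0 < b) : cfFinite l ∈ Set.Icc (0 : ℝ) 1 := by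
  induction l with
  | nil => simp [cfFinite]
  | cons b l ih =>
    have h := ih fun c hc => hl c (List.mem_cons_of_mem _ hc)
    have hb : (1 : ℝ) ≤ b := by exact_mod_cast hl b List.mem_cons_self
    have h1 : 1 ≤ (b : ℝ) + cfFinite l := by linarith [h.1]
    exact ⟨by rw [cfFinite]; positivity, by rw [cfFinite, div_le_one (by linarith)]; exact h1⟩

/-- The tail `[a_{n+1}, a_{n+2}, …]`. -/
noncomputable def cfTail (a : ℕ → ℕ) (n : ℕ) : ℝ := cfInfinite fun k => a (n + 1 + k)

theorem cfTail_eq_of_tendsto {a : ℕ → ℕ} {n : ℕ} {x : ℝ}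
    (h : Tendsto (fun m => cfFinite ((List.range' (n + 1) m).map a)) atTop (𝓝 x)) :
    cfTail a n = x := by
  refine Tendsto.limUnder_eq ?_
  convert h using 3 with m
  rw [List.range'_eq_map_range, List.map_map]
  rfl

section

variable {α : ℝ} {a : ℕ → ℕ}

/-- `cfInfinite` is only meaningful once convergence is known. Convergence passes from one tail to
the next by continuity of `x ↦ 1/x - a_{n+1}` at a nonzero limit; irrationality passes along too and
excludes the endpoints of `[0,1]`. -/
theorem HasContinuedFraction.tail (ha : HasContinuedFraction α a) (hα : α ∈ Set.Ioo (0 : ℝ) 1)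
    (hirr : Irrational α) (n : ℕ) :
    Tendsto (fun m => cfFinite ((List.range' (n + 1) m).map a)) atTop (𝓝 (cfTail a n)) ∧
      Irrational (cfTail a n) ∧ cfTail a n ∈ Set.Ioo (0 : ℝ) 1 ∧
      cfTail a (n + 1) = 1 / cfTail a n - a (n + 1) := by
  have step : ∀ n, Tendsto (fun m => cfFinite ((List.range' (n + 1) m).map a)) atTop
      (𝓝 (cfTail a n)) → cfTail a n ∈ Set.Ioo (0 : ℝ) 1 →
      Tendsto (fun m => cfFinite ((List.range' (n + 2) m).map a)) atTop
        (𝓝 (1 / cfTail a n - a (n + 1))) := by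
    intro n h1 h2
    have h3 := ((tendsto_const_nhds (x := (1 : ℝ))).div
      ((tendsto_add_atTop_iff_nat 1).2 h1) h2.1.ne').sub_const (a (n + 1) : ℝ)
    convert h3 using 2 with m
    rw [Pi.div_apply, List.range'_succ, List.map_cons, cfFinite, one_div_one_div]
    ring
  induction n with
  | zero =>
    have h0 : cfTail a 0 = α := cfTail_eq_of_tendsto ha.2
    have h1 : Tendsto (fun m => cfFinite ((List.range' (0 + 1) m).map a)) atTop
        (𝓝 (cfTail a 0)) := by rw [h0]; exact ha.2
    have h2 : cfTail a 0 ∈ Set.Ioo (0 : ℝ) 1 := by rwa [h0]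
    exact ⟨h1, by rwa [h0], h2, cfTail_eq_of_tendsto (step 0 h1 h2)⟩
  | succ n ih =>
    obtain ⟨h1, h2, h3, h4⟩ := ih
    have h5 : Tendsto (fun m => cfFinite ((List.range' (n + 1 + 1) m).map a)) atTop
        (𝓝 (cfTail a (n + 1))) := by rw [h4]; exact step n h1 h3
    have h6 : Irrational (cfTail a (n + 1)) := by
      rw [h4, one_div]
      exact h2.inv.sub_natCast _
    have h7 : cfTail a (n + 1) ∈ Set.Icc (0 : ℝ) 1 := by
      refine isClosed_Icc.mem_of_tendsto h5 (Eventually.of_forall fun m => cfFinite_mem_Icc ?_)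
      intro b hb
      obtain ⟨k, hk, rfl⟩ := List.mem_map.1 hb
      rw [List.mem_range'_1] at hk
      exact ha.1 k (by omega)
    have h8 : cfTail a (n + 1) ∈ Set.Ioo (0 : ℝ) 1 :=
      ⟨lt_of_le_of_ne h7.1 (h6.ne_zero).symm, lt_of_le_of_ne h7.2 h6.ne_one⟩
    exact ⟨h5, h6, h8, cfTail_eq_of_tendsto (step (n + 1) h5 h8)⟩

theorem HasContinuedFraction.tail_zero (ha : HasContinuedFraction α a) : cfTail a 0 = α :=
  cfTail_eq_of_tendsto ha.2

theorem HasContinuedFraction.one_div_tail (ha : HasContinuedFraction α a)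
    (hα : α ∈ Set.Ioo (0 : ℝ) 1) (hirr : Irrational α) (n : ℕ) :
    1 / cfTail a n = a (n + 1) + cfTail a (n + 1) := by
  rw [(ha.tail hα hirr n).2.2.2]; ring

theorem HasContinuedFraction.tail_pos (ha : HasContinuedFraction α a)
    (hα : α ∈ Set.Ioo (0 : ℝ) 1) (hirr : Irrational α) (n : ℕ) : 0 < cfTail a n :=
  (ha.tail hα hirr n).2.2.1.1

/-! ### Convergents -/

/-- Numerators of the convergents, starting from the convergent `1/0`. -/
def cvNum (a : ℕ → ℕ) : ℕ → ℤ
  | 0 => 1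
  | 1 => 0
  | n + 2 => a (n + 1) * cvNum a (n + 1) + cvNum a n

/-- Denominators of the convergents, starting from the convergent `1/0`. -/
def cvDen (a : ℕ → ℕ) : ℕ → ℤ
  | 0 => 0
  | 1 => 1
  | n + 2 => a (n + 1) * cvDen a (n + 1) + cvDen a n

theorem cvNum_mul_cvDen_sub (a : ℕ → ℕ) (n : ℕ) :
    cvNum a n * cvDen a (n + 1) - cvDen a n * cvNum a (n + 1) = (-1) ^ n := by
  induction n with
  | zero => simp [cvNum, cvDen]
  | succ n ih =>
    rw [cvNum, cvDen, pow_succ, ← ih]; ring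

theorem cvDen_nonneg_and_one_le (ha : HasContinuedFraction α a) (n : ℕ) :
    0 ≤ cvDen a n ∧ 1 ≤ cvDen a (n + 1) := by
  induction n with
  | zero => simp [cvDen]
  | succ n ih =>
    have h : (1 : ℤ) ≤ a (n + 1) := by exact_mod_cast ha.1 (n + 1) (by omega)
    refine ⟨by linarith, ?_⟩
    rw [cvDen]
    nlinarith

theorem cvDen_nonneg (ha : HasContinuedFraction α a) (n : ℕ) : (0 : ℝ) ≤ cvDen a n := by
  exact_mod_cast (cvDen_nonneg_and_one_le ha n).1

theorem cvDen_succ_pos (ha : HasContinuedFraction α a) (n : ℕ) : (0 : ℝ) < cvDen a (n + 1) := by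
  exact_mod_cast zero_lt_one.trans_le (cvDen_nonneg_and_one_le ha n).2

theorem le_cvDen_succ (ha : HasContinuedFraction α a) (n : ℕ) : (n : ℤ) ≤ cvDen a (n + 1) := by
  induction n with
  | zero => simp [cvDen]
  | succ n ih =>
    -- The increment comes from `1 ≤ cvDen a (n + 1)`; the first step is separate because `cvDen a 0
    -- = 0`.
    rcases n with _ | n
    · exact (cvDen_nonneg_and_one_le ha 1).2
    · have h : (1 : ℤ) ≤ a (n + 1 + 1) := by exact_mod_cast ha.1 (n + 1 + 1) (by omega)
      have h1 := (cvDen_nonneg_and_one_le ha n).2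
      rw [cvDen]
      push_cast at *
      nlinarith

theorem cvDen_div_eq (ha : HasContinuedFraction α a) (n : ℕ) :
    (cvDen a n : ℝ) / cvDen a (n + 1) = cfFinite ((List.range' 1 n).map a).reverse := by
  induction n with
  | zero => simp [cvDen, cfFinite]
  | succ n ih =>
    have h1 := cvDen_succ_pos ha n
    have h2 := cvDen_succ_pos ha (n + 1)
    rw [List.range'_concat, List.map_append, List.reverse_append]
    simp only [List.map_cons, List.map_nil, List.reverse_cons, List.reverse_nil, List.nil_append,
      List.cons_append, cfFinite, one_mul]
    rw [← ih, cvDen, add_comm 1 n]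
    push_cast
    field_simp

/-- The distances `|q α - p|` for the convergents `p/q`. -/
noncomputable def cvDist (a : ℕ → ℕ) (n : ℕ) : ℝ := ∏ k ∈ Finset.range n, cfTail a k

theorem cvDist_succ (a : ℕ → ℕ) (n : ℕ) : cvDist a (n + 1) = cvDist a n * cfTail a n :=
  Finset.prod_range_succ _ _

theorem cvDist_pos (ha : HasContinuedFraction α a)
    (hα : α ∈ Set.Ioo (0 : ℝ) 1) (hirr : Irrational α) (n : ℕ) : 0 < cvDist a n :=
  Finset.prod_pos fun k _ => ha.tail_pos hα hirr k

theorem cvDist_eq (ha : HasContinuedFraction α a)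
    (hα : α ∈ Set.Ioo (0 : ℝ) 1) (hirr : Irrational α) (n : ℕ) :
    cvDist a n = cvDist a (n + 1) * (a (n + 1) + cfTail a (n + 1)) := by
  have h := ha.tail_pos hα hirr n
  rw [← ha.one_div_tail hα hirr, cvDist_succ]
  field_simp

theorem cvDist_add_two (ha : HasContinuedFraction α a)
    (hα : α ∈ Set.Ioo (0 : ℝ) 1) (hirr : Irrational α) (n : ℕ) :
    cvDist a (n + 2) = cvDist a n - a (n + 1) * cvDist a (n + 1) := by
  rw [cvDist_eq ha hα hirr n, cvDist_succ a (n + 1)]; ring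

/-- This is the unimodularity of the basis of consecutive convergents, written in the coordinates
`y` and `x - α y`. -/
theorem cvDen_mul_cvDist (ha : HasContinuedFraction α a)
    (hα : α ∈ Set.Ioo (0 : ℝ) 1) (hirr : Irrational α) (n : ℕ) :
    cvDen a (n + 1) * cvDist a n + cvDen a n * cvDist a (n + 1) = 1 := by
  induction n with
  | zero => simp [cvDen, cvDist]
  | succ n ih =>
    rw [cvDist_add_two ha hα hirr, cvDen]
    push_cast
    linear_combination ih

theorem cvNum_sub_mul_cvDen (ha : HasContinuedFraction α a)
    (hα : α ∈ Set.Ioo (0 : ℝ) 1) (hirr : Irrational α) (n : ℕ) :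
    (cvNum a n : ℝ) - α * cvDen a n = (-1) ^ n * cvDist a n ∧
      (cvNum a (n + 1) : ℝ) - α * cvDen a (n + 1) = (-1) ^ (n + 1) * cvDist a (n + 1) := by
  induction n with
  | zero => simp [cvNum, cvDen, cvDist, ha.tail_zero]
  | succ n ih =>
    refine ⟨ih.2, ?_⟩
    rw [cvDist_add_two ha hα hirr, cvNum, cvDen]
    push_cast
    linear_combination a (n + 1) * ih.2 + ih.1

/-! ### Areas of lattice vectors in the basis of two consecutive convergents -/

/-- Put `β = cvDen a n / cvDen a (n + 1)` and `γ = a (n + 1) + cfTail a (n + 1)`. Then `w 1 = cvDen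
a (n + 1) * (b β + c)` and `|w 0 - α * w 1| = cvDist a (n + 1) * (b γ - c)`, the sign being settled
by `hbc`; the product of the two prefactors is `1 / (β + γ)`. -/
theorem areaAt_combination (ha : HasContinuedFraction α a)
    (hα : α ∈ Set.Ioo (0 : ℝ) 1) (hirr : Irrational α) (n : ℕ) {w : Fin 2 → ℝ} {b c : ℝ}
    (h0 : w 0 = b * cvNum a n + c * cvNum a (n + 1))
    (h1 : w 1 = b * cvDen a n + c * cvDen a (n + 1))
    (hb : 0 ≤ b) (hc : 0 ≤ c) (hbc : c ≤ a (n + 1) * b) :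
    areaAt α w * (cvDen a n / cvDen a (n + 1) + (a (n + 1) + cfTail a (n + 1))) =
      (b * (cvDen a n / cvDen a (n + 1)) + c) * (b * (a (n + 1) + cfTail a (n + 1)) - c) := by
  have hQ := cvDen_succ_pos ha n
  have hQ0 := cvDen_nonneg ha n
  have hE := cvDist_pos ha hα hirr (n + 1)
  have hx := ha.tail_pos hα hirr (n + 1)
  have hEn := cvDist_eq ha hα hirr n
  have hdet := cvDen_mul_cvDist ha hα hirr n
  obtain ⟨hs1, hs2⟩ := cvNum_sub_mul_cvDen ha hα hirr n
  have hd : w 0 - α * w 1 = (-1) ^ n * (b * cvDist a n - c * cvDist a (n + 1)) := by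
    rw [h0, h1]
    rw [pow_succ] at hs2
    linear_combination b * hs1 + c * hs2
  have hpos : 0 ≤ b * cvDist a n - c * cvDist a (n + 1) := by
    rw [hEn]
    have : 0 ≤ cvDist a (n + 1) * ((a (n + 1) * b - c) + b * cfTail a (n + 1)) :=
      mul_nonneg hE.le (add_nonneg (by linarith) (mul_nonneg hb hx.le))
    linarith
  have hw1 : 0 ≤ w 1 := by rw [h1]; positivity
  rw [areaAt, hd, abs_mul, abs_pow, abs_neg, abs_one, one_pow, one_mul, abs_of_nonneg hpos,
    abs_of_nonneg hw1, h1]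
  rw [hEn] at hdet ⊢
  set γ := (a (n + 1) : ℝ) + cfTail a (n + 1)
  have h2 : cvDist a (n + 1) = 1 / (cvDen a (n + 1) * γ + cvDen a n) := by
    have : (cvDen a (n + 1) : ℝ) * γ + cvDen a n ≠ 0 := by
      intro h
      have : cvDist a (n + 1) * (cvDen a (n + 1) * γ + cvDen a n) = 1 := by linarith
      rw [h] at this; simp at this
    field_simp
    linarith
  have h3 : 0 < (cvDen a (n + 1) : ℝ) * γ + cvDen a n := by
    have : 0 < γ := by positivity
    positivity
  rw [h2]
  field_simp
  ring

/-- Both cases of `cfD` have one closed form: `a (n + 1) + cfTail a (n + 1) - i` has first digit `a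
(n + 1) - i`, and when that digit is `0` its reciprocal is a complete quotient. -/
theorem cfD_succ_eq (ha : HasContinuedFraction α a)
    (hα : α ∈ Set.Ioo (0 : ℝ) 1) (hirr : Irrational α) {n i : ℕ} (hi : i ≤ a (n + 1)) :
    cfD a (n + 1) i = 1 / (cvDen a n / cvDen a (n + 1) + i) +
      1 / (a (n + 1) + cfTail a (n + 1) - i) := by
  have hw : ∀ j, cfFinite (cfWord a (n + 1) j).reverse =
      1 / (cvDen a n / cvDen a (n + 1) + j) := by
    intro j
    rw [cfWord, List.reverse_append, List.reverse_singleton, List.singleton_append, cfFinite,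
      Nat.add_sub_cancel, cvDen_div_eq ha, add_comm]
  unfold cfD
  split_ifs with h
  · have h2 := ha.one_div_tail hα hirr (n + 1)
    rw [hw, ← h, add_sub_cancel_left, h2, add_assoc]
    rfl
  · rw [hw]
    congr 1
    refine Tendsto.limUnder_eq ?_
    -- Truncations of length `m + 1` have a first digit to split off.
    rw [← tendsto_add_atTop_iff_nat 1]
    have h1 := (tendsto_const_nhds (x := (1 : ℝ))).div
      ((ha.tail hα hirr (n + 1)).1.const_add ((a (n + 1) : ℝ) - i)) (by
        have : (i : ℝ) ≤ a (n + 1) := by exact_mod_cast hi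
        have := ha.tail_pos hα hirr (n + 1)
        linarith)
    rw [add_sub_right_comm]
    convert h1 using 2 with m
    rw [List.range_succ_eq_map, List.map_cons, List.map_map, cfFinite]
    simp only [if_true, Nat.cast_sub hi]
    congr 3
    rw [List.range'_eq_map_range, List.map_map]
    congr 1
    ext k
    simp [add_comm, add_left_comm]

/-- Taking `b = 1` and `c = i` in `areaAt_combination` gives the area `(β + i)(γ - i) / (β + γ)`,
whose inverse is `1/(β + i) + 1/(γ - i)`. -/
theorem areaAt_mul_cfD (ha : HasContinuedFraction α a)
    (hα : α ∈ Set.Ioo (0 : ℝ) 1) (hirr : Irrational α) {n i : ℕ} (hi1 : 1 ≤ i)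
    (hi : i ≤ a (n + 1)) {w : Fin 2 → ℝ}
    (h0 : w 0 = cvNum a n + i * cvNum a (n + 1)) (h1 : w 1 = cvDen a n + i * cvDen a (n + 1)) :
    areaAt α w * cfD a (n + 1) i = 1 := by
  have hQ := cvDen_succ_pos ha n
  have hQ0 := cvDen_nonneg ha n
  have hx := ha.tail_pos hα hirr (n + 1)
  have hi' : (i : ℝ) ≤ a (n + 1) := by exact_mod_cast hi
  have hi1' : (1 : ℝ) ≤ i := by exact_mod_cast hi1
  have h := areaAt_combination ha hα hirr n (w := w) (b := 1) (c := i) (by linarith)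
    (by linarith) zero_le_one (by linarith) (by linarith)
  rw [cfD_succ_eq ha hα hirr hi]
  set β := (cvDen a n : ℝ) / cvDen a (n + 1) with hβ
  have hβ0 : 0 ≤ β := by positivity
  set γ := (a (n + 1) : ℝ) + cfTail a (n + 1)
  have hγ : 0 < γ - i := by simp only [γ]; linarith
  have hβi : 0 < β + i := by linarith
  have h2 : 1 / (β + i) + 1 / (γ - i) = (β + γ) / ((β + i) * (γ - i)) := by
    field_simp; ring
  rw [h2, ← mul_div_assoc, h, one_mul, one_mul, div_self (by positivity)]

theorem cfD_pos (ha : HasContinuedFraction α a)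
    (hα : α ∈ Set.Ioo (0 : ℝ) 1) (hirr : Irrational α) {n i : ℕ} (hi1 : 1 ≤ i)
    (hi : i ≤ a (n + 1)) : 0 < cfD a (n + 1) i := by
  have hQ := cvDen_succ_pos ha n
  have hQ0 := cvDen_nonneg ha n
  have hx := ha.tail_pos hα hirr (n + 1)
  have hi' : (i : ℝ) ≤ a (n + 1) := by exact_mod_cast hi
  have hi1' : (1 : ℝ) ≤ i := by exact_mod_cast hi1
  rw [cfD_succ_eq ha hα hirr hi]
  have : 0 < (a (n + 1) : ℝ) + cfTail a (n + 1) - i := by linarith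
  positivity

theorem cfD_self_eq (ha : HasContinuedFraction α a)
    (hα : α ∈ Set.Ioo (0 : ℝ) 1) (hirr : Irrational α) (n : ℕ) :
    cfD a (n + 1) (a (n + 1)) = cvDen a (n + 1) / cvDen a (n + 2) +
      (a (n + 2) + cfTail a (n + 2)) := by
  have hQ := cvDen_succ_pos ha n
  rw [cfD_succ_eq ha hα hirr le_rfl, add_sub_cancel_left, ha.one_div_tail hα hirr, cvDen]
  push_cast
  field_simp
  ring_nf

/-- Bounds on complete quotients from bounds on the areas of the convergents. -/
theorem inv_le_of_cfD_le (ha : HasContinuedFraction α a)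
    (hα : α ∈ Set.Ioo (0 : ℝ) 1) (hirr : Irrational α) {Λ : ℝ} {n : ℕ}
    (h1 : cfD a (n + 1) (a (n + 1)) ≤ Λ) (h3 : cfD a (n + 3) (a (n + 3)) ≤ Λ) :
    0 < Λ ∧ 1 / Λ ≤ cvDen a (n + 2) / cvDen a (n + 3) ∧ 1 / Λ ≤ cfTail a (n + 3) := by
  have hΛ : 0 < Λ := (cfD_pos ha hα hirr (ha.1 (n + 1) (by omega)) le_rfl).trans_le h1
  have hQ1 := cvDen_succ_pos ha n
  have hQ2 := cvDen_succ_pos ha (n + 1)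
  have hQ3 := cvDen_succ_pos ha (n + 2)
  have hQ4 := cvDen_succ_pos ha (n + 3)
  rw [cfD_self_eq ha hα hirr] at h1 h3
  -- The earlier convergent bounds `a (n + 2) + cvDen a (n + 1) / cvDen a (n + 2)`, the inverse of
  -- the first ratio; the later one bounds `a (n + 4) + cfTail a (n + 4)`, the inverse of the tail.
  refine ⟨hΛ, ?_, ?_⟩
  · have hx := ha.tail_pos hα hirr (n + 2)
    have e : (cvDen a (n + 3) : ℝ) / cvDen a (n + 2) =
        a (n + 2) + cvDen a (n + 1) / cvDen a (n + 2) := by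
      rw [cvDen]; push_cast; field_simp
    rw [div_le_div_iff₀ hΛ hQ3, one_mul]
    rw [div_add' _ _ _ hQ2.ne', div_le_iff₀ hQ2] at h1
    have e2 : (cvDen a (n + 3) : ℝ) = a (n + 2) * cvDen a (n + 2) + cvDen a (n + 1) := by
      rw [cvDen]; push_cast; rfl
    rw [e2]
    nlinarith
  · have hx := ha.tail_pos hα hirr (n + 3)
    have e := ha.one_div_tail hα hirr (n + 3)
    rw [div_le_comm₀ hΛ hx, e]
    have : 0 < (cvDen a (n + 3) : ℝ) / cvDen a (n + 4) := by positivity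
    linarith

/-- Lattice vectors that are not on the boundary of the Klein polygon have a large area. -/
theorem le_areaAt_of_two_le (ha : HasContinuedFraction α a)
    (hα : α ∈ Set.Ioo (0 : ℝ) 1) (hirr : Irrational α) {n : ℕ} {w : Fin 2 → ℝ} {b c Λ : ℝ}
    (h0 : w 0 = b * cvNum a n + c * cvNum a (n + 1))
    (h1 : w 1 = b * cvDen a n + c * cvDen a (n + 1))
    (hb : 2 ≤ b) (hc : 1 ≤ c) (hbc : c + 1 ≤ a (n + 1) * b) (hΛ : 0 < Λ)
    (hβ : 1 / Λ ≤ cvDen a n / cvDen a (n + 1)) (hx : 1 / Λ ≤ cfTail a (n + 1)) :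
    1 + 2 / Λ ≤ areaAt α w := by
  have h := areaAt_combination ha hα hirr n h0 h1 (by linarith) (by linarith) (by linarith)
  set β := (cvDen a n : ℝ) / cvDen a (n + 1) with hβ'
  set x := cfTail a (n + 1)
  have hΛ' : 0 < 1 / Λ := by positivity
  have hu : 1 + 2 / Λ ≤ b * β + c := by
    have : 2 * (1 / Λ) ≤ b * β := by gcongr
    have e : 2 / Λ = 2 * (1 / Λ) := by ring
    linarith
  have hv : 1 + 2 / Λ ≤ b * (a (n + 1) + x) - c := by
    have : 2 * (1 / Λ) ≤ b * x := by gcongr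
    have e : 2 / Λ = 2 * (1 / Λ) := by ring
    linarith
  set u := b * β + c with hu'
  set v := b * (a (n + 1) + x) - c with hv'
  set K := 1 + 2 / Λ with hK
  have hK0 : 0 < K := by positivity
  have huv : u + v = b * (β + (a (n + 1) + x)) := by rw [hu', hv']; ring
  have hs : 0 < β + (a (n + 1) + x) := by
    have : (0 : ℝ) ≤ a (n + 1) := by positivity
    linarith
  -- Since `u, v ≥ K`, one has `2uv ≥ K(u + v)`, while `u + v ≥ 2(β + γ)` with `γ = a (n + 1) + x`
  -- because `b ≥ 2`. Hence `uv / (β + γ) ≥ K`.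
  by_contra! hcon
  have h2 : u * v < K * (β + (a (n + 1) + x)) := by rw [← h]; gcongr
  have h3 : 2 * (β + (a (n + 1) + x)) ≤ u + v := by rw [huv]; gcongr
  have h4 : K * (2 * (β + (a (n + 1) + x))) ≤ K * (u + v) := by gcongr
  nlinarith [mul_nonneg (hK0.le.trans hu) (sub_nonneg.2 hv),
    mul_nonneg (hK0.le.trans hv) (sub_nonneg.2 hu)]

/-! ### Expansion of lattice vectors -/

/-- The coordinates of `(p, q)` in the bases of consecutive convergents. -/
def cvCoord (a : ℕ → ℕ) (p q : ℤ) : ℕ → ℤ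
  | 0 => q
  | 1 => p
  | n + 2 => cvCoord a p q n - a (n + 1) * cvCoord a p q (n + 1)

theorem eq_cvCoord_combination (a : ℕ → ℕ) (p q : ℤ) (n : ℕ) :
    p = cvCoord a p q (n + 1) * cvNum a n + cvCoord a p q n * cvNum a (n + 1) ∧
      q = cvCoord a p q (n + 1) * cvDen a n + cvCoord a p q n * cvDen a (n + 1) := by
  induction n with
  | zero => simp [cvCoord, cvNum, cvDen]
  | succ n ih =>
    rw [cvCoord, cvNum, cvDen]
    constructor
    · linear_combination ih.1
    · linear_combination ih.2

/-- Cramer's rule in the unimodular basis. It shows that the coordinate of fixed index `n` is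
positive once `q > 0` and `|p - α q|` is small. -/
theorem cvCoord_eq (ha : HasContinuedFraction α a)
    (hα : α ∈ Set.Ioo (0 : ℝ) 1) (hirr : Irrational α) (p q : ℤ) (n : ℕ) :
    (cvCoord a p q n : ℝ) = q * cvDist a n - (-1) ^ n * (p - α * q) * cvDen a n := by
  obtain ⟨hs1, hs2⟩ := cvNum_sub_mul_cvDen ha hα hirr n
  have hdet := cvDen_mul_cvDist ha hα hirr n
  obtain ⟨hp, hq⟩ := eq_cvCoord_combination a p q n
  have hp' : (p : ℝ) = cvCoord a p q (n + 1) * cvNum a n + cvCoord a p q n * cvNum a (n + 1) := by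
    exact_mod_cast hp
  have hq' : (q : ℝ) = cvCoord a p q (n + 1) * cvDen a n + cvCoord a p q n * cvDen a (n + 1) := by
    exact_mod_cast hq
  set B := (cvCoord a p q n : ℝ)
  set B' := (cvCoord a p q (n + 1) : ℝ)
  have hsq : ((-1 : ℝ) ^ n) * (-1) ^ n = 1 := by rw [← mul_pow]; norm_num
  have hd : (-1) ^ n * ((p : ℝ) - α * q) = B' * cvDist a n - B * cvDist a (n + 1) := by
    rw [hp', hq']
    rw [pow_succ] at hs2
    linear_combination (-1) ^ n * B' * hs1 + (-1) ^ n * B * hs2 +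
      (B' * cvDist a n - B * cvDist a (n + 1)) * hsq
  rw [hd]
  nth_rewrite 1 [hq']
  linear_combination (-B) * hdet

/-- Descent: as long as the coordinates are positive, the sum of two consecutive ones strictly
decreases, because each digit is at least `1`. -/
theorem exists_cvCoord_nonpos (ha : HasContinuedFraction α a) (p q : ℤ) {n : ℕ}
    (h0 : 0 < cvCoord a p q n) (h1 : 0 < cvCoord a p q (n + 1)) :
    ∃ m ≥ n, 0 < cvCoord a p q m ∧ 0 < cvCoord a p q (m + 1) ∧ cvCoord a p q (m + 2) ≤ 0 := by
  obtain ⟨k, hk⟩ : ∃ k : ℕ, cvCoord a p q n + cvCoord a p q (n + 1) ≤ k :=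
    ⟨(cvCoord a p q n + cvCoord a p q (n + 1)).toNat, Int.self_le_toNat _⟩
  induction k generalizing n with
  | zero => push_cast at hk; omega
  | succ k ih =>
    by_cases h2 : cvCoord a p q (n + 2) ≤ 0
    · exact ⟨n, le_rfl, h0, h1, h2⟩
    · have h3 : cvCoord a p q (n + 2) =
        cvCoord a p q n - a (n + 1) * cvCoord a p q (n + 1) := by rw [cvCoord]
      have h4 : (1 : ℤ) ≤ a (n + 1) := by exact_mod_cast ha.1 (n + 1) (by omega)
      obtain ⟨m, hm, H⟩ := ih (n := n + 1) h1 (by rw [h3] at h2 ⊢; omega)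
        (by rw [h3]; push_cast at hk; nlinarith)
      exact ⟨m, by omega, H⟩

/-- Primitive vectors close to the line of co-slope `α` are nonnegative combinations of
consecutive convergents of large index. -/
theorem exists_combination (ha : HasContinuedFraction α a)
    (hα : α ∈ Set.Ioo (0 : ℝ) 1) (hirr : Irrational α) (N : ℕ) :
    ∃ δ > 0, ∀ p q : ℤ, 0 < q → IsCoprime p q → |(p : ℝ) - α * q| < δ →
      ∃ n ≥ N, ∃ b c : ℤ, p = b * cvNum a n + c * cvNum a (n + 1) ∧
        q = b * cvDen a n + c * cvDen a (n + 1) ∧ 0 < b ∧ 0 < c ∧ c ≤ a (n + 1) * b ∧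
        (b = 1 ∨ c < a (n + 1) * b) := by
  have hpos : ∀ n, 0 < cvDist a n / (cvDen a n + 1) := fun n =>
    div_pos (cvDist_pos ha hα hirr n) (by linarith [cvDen_nonneg ha n])
  -- Chosen so that `cvCoord_eq` makes the coordinates of index `N` and `N + 1` positive, which
  -- starts the descent.
  refine ⟨min (cvDist a N / (cvDen a N + 1)) (cvDist a (N + 1) / (cvDen a (N + 1) + 1)),
    lt_min (hpos _) (hpos _), fun p q hq hpq hd => ?_⟩
  rw [lt_min_iff] at hd
  have key : ∀ n, |(p : ℝ) - α * q| < cvDist a n / (cvDen a n + 1) → 0 < cvCoord a p q n := by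
    intro n h
    have hQ := cvDen_nonneg ha n
    rw [lt_div_iff₀ (by linarith)] at h
    have hq1 : (1 : ℝ) ≤ q := by exact_mod_cast hq
    have h2 : (-1) ^ n * ((p : ℝ) - α * q) * cvDen a n ≤ |(p : ℝ) - α * q| * cvDen a n := by
      gcongr
      calc _ ≤ |(-1) ^ n * ((p : ℝ) - α * q)| := le_abs_self _
        _ = _ := by rw [abs_mul, abs_pow, abs_neg, abs_one, one_pow, one_mul]
    have h3 : 0 < (cvCoord a p q n : ℝ) := by
      rw [cvCoord_eq ha hα hirr]
      have h4 := cvDist_pos ha hα hirr n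
      nlinarith [abs_nonneg ((p : ℝ) - α * q)]
    exact_mod_cast h3
  obtain ⟨n, hn, h0, h1, h2⟩ := exists_cvCoord_nonpos ha p q (key N hd.1) (key (N + 1) hd.2)
  obtain ⟨hp, hq'⟩ := eq_cvCoord_combination a p q n
  rw [cvCoord] at h2
  refine ⟨n, hn, _, _, hp, hq', h1, h0, by linarith, ?_⟩
  -- If `c = a (n + 1) * b`, then `b` divides both `p` and `q`, so `b = 1` by coprimality.
  by_contra! hcon
  have h3 : cvCoord a p q n = a (n + 1) * cvCoord a p q (n + 1) := by omega
  have hdvd : cvCoord a p q (n + 1) ∣ cvCoord a p q n := ⟨_, h3.trans (mul_comm _ _)⟩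
  have hu : IsUnit (cvCoord a p q (n + 1)) := by
    refine hpq.isUnit_of_dvd' ?_ ?_
    · exact (dvd_add (dvd_mul_right _ _) (hdvd.mul_right _)).trans hp.symm.dvd
    · exact (dvd_add (dvd_mul_right _ _) (hdvd.mul_right _)).trans hq'.symm.dvd
  rcases Int.isUnit_iff.1 hu with h | h
  · exact hcon.1 h
  · omega

/-! ### The renormalizing matrices -/

/-- `gSigned` recurses on the first digit, its rightmost factor, whereas induction on convergents
adds the last digit on the left. -/
theorem gSigned_append (ε : ℤ) (l : List ℕ) (b : ℕ) :
    gSigned ε (l ++ [b]) =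
      ModularGroup.T ^ (ε * (-1) ^ l.length * b) * ModularGroup.S * gSigned ε l := by
  induction l generalizing ε with
  | nil => simp [gSigned]
  | cons c l ih =>
    rw [List.cons_append, gSigned, ih, gSigned, List.length_cons, pow_succ]
    simp only [mul_assoc, neg_mul, mul_neg, mul_one]

theorem T_zpow_mul_S_mulVec (k : ℤ) (v : Fin 2 → ℤ) :
    (ModularGroup.T ^ k * ModularGroup.S : SL(2, ℤ)).1.mulVec v = ![k * v 0 - v 1, v 0] := by
  rw [Matrix.SpecialLinearGroup.coe_mul, ModularGroup.coe_T_zpow, ModularGroup.coe_S]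
  ext j
  fin_cases j <;> simp [Matrix.mulVec, dotProduct, Fin.sum_univ_two, Matrix.mul_apply]
  ring

/-- The new factor sends `(x, y)` to `(k x - y, x)`. The alternating sign of `k` cancels the first
coordinate of the image of `V_{n+2} = a_{n+1} V_{n+1} + V_n`. -/
theorem gMatrix_mulVec_convergents (a : ℕ → ℕ) (n : ℕ) : ∃ s : ℤ, (s = 1 ∨ s = -1) ∧
    (gMatrix ((List.range' 1 n).map a)).1.mulVec ![cvNum a n, cvDen a n] = ![s, 0] ∧
    (gMatrix ((List.range' 1 n).map a)).1.mulVec ![cvNum a (n + 1), cvDen a (n + 1)] =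
      ![0, (-1) ^ n * s] := by
  induction n with
  | zero =>
    refine ⟨1, Or.inl rfl, ?_, ?_⟩ <;> ext j <;> fin_cases j <;>
      simp [gMatrix, gSigned, cvNum, cvDen]
  | succ n ih =>
    obtain ⟨s, hs, h1, h2⟩ := ih
    have hg : gMatrix ((List.range' 1 (n + 1)).map a) =
        ModularGroup.T ^ ((-1) ^ n * (a (n + 1) : ℤ)) * ModularGroup.S *
          gMatrix ((List.range' 1 n).map a) := by
      rw [List.range'_concat, List.map_append, List.map_singleton, gMatrix, gSigned_append]
      simp [gMatrix, add_comm]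
    have hv : (![cvNum a (n + 2), cvDen a (n + 2)] : Fin 2 → ℤ) =
        (a (n + 1) : ℤ) • ![cvNum a (n + 1), cvDen a (n + 1)] + ![cvNum a n, cvDen a n] := by
      ext j; fin_cases j <;> simp [cvNum, cvDen]
    refine ⟨-((-1) ^ n * s), ?_, ?_, ?_⟩
    · rcases neg_one_pow_eq_or ℤ n with h | h <;> rcases hs with rfl | rfl <;> simp [h]
    · rw [hg, Matrix.SpecialLinearGroup.coe_mul, ← Matrix.mulVec_mulVec, h2, T_zpow_mul_S_mulVec]
      simp
    · rw [hg, Matrix.SpecialLinearGroup.coe_mul, ← Matrix.mulVec_mulVec, hv, Matrix.mulVec_add,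
        Matrix.mulVec_smul, h1, h2, T_zpow_mul_S_mulVec]
      ext j; fin_cases j
      · simp; ring
      · rcases neg_one_pow_eq_or ℤ n with h | h <;> simp [pow_succ, h]

/-- The same cancellation with `i` as last digit makes the image of `V_n + i V_{n+1}` vertical; the
extra `R` turns it horizontal. -/
theorem slopeMultiplicity_act_gMatrix (S : Origami) (a : ℕ → ℕ) (n i : ℕ) :
    slopeMultiplicity 1 0 (S.act (ModularGroup.S * gMatrix (cfWord a (n + 1) i))) =
      slopeMultiplicity (cvNum a n + i * cvNum a (n + 1)) (cvDen a n + i * cvDen a (n + 1))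
        S.flat := by
  obtain ⟨s, hs, h1, h2⟩ := gMatrix_mulVec_convergents a n
  apply slopeMultiplicity_act
  have hg : gMatrix (cfWord a (n + 1) i) =
      ModularGroup.T ^ ((-1) ^ n * (i : ℤ)) * ModularGroup.S *
        gMatrix ((List.range' 1 n).map a) := by
    rw [cfWord, gMatrix, gSigned_append]
    simp [gMatrix]
  have hv : (![cvNum a n + i * cvNum a (n + 1), cvDen a n + i * cvDen a (n + 1)] : Fin 2 → ℤ) =
      ![cvNum a n, cvDen a n] + (i : ℤ) • ![cvNum a (n + 1), cvDen a (n + 1)] := by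
    ext j; fin_cases j <;> simp
  have : (ModularGroup.S * gMatrix (cfWord a (n + 1) i)).1.mulVec
      ![cvNum a n + i * cvNum a (n + 1), cvDen a n + i * cvDen a (n + 1)] = ![-s, 0] := by
    rw [hg, Matrix.SpecialLinearGroup.coe_mul, Matrix.SpecialLinearGroup.coe_mul,
      ← Matrix.mulVec_mulVec, ← Matrix.mulVec_mulVec, hv, Matrix.mulVec_add,
      Matrix.mulVec_smul, h1, h2, T_zpow_mul_S_mulVec, ModularGroup.coe_S]
    ext j; fin_cases j
    · simp
    · simp; ring
  rw [this]
  rcases hs with rfl | rfl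
  · right; rfl
  · left; simp

theorem isCoprime_intermediate (a : ℕ → ℕ) (n i : ℕ) :
    IsCoprime (cvNum a n + i * cvNum a (n + 1)) (cvDen a n + i * cvDen a (n + 1)) := by
  have h := cvNum_mul_cvDen_sub a n
  rcases neg_one_pow_eq_or ℤ n with h' | h' <;> rw [h'] at h
  · exact ⟨cvDen a (n + 1), -cvNum a (n + 1), by linear_combination h⟩
  · exact ⟨-cvDen a (n + 1), cvNum a (n + 1), by linear_combination -h⟩

end

/-! ### Comparison of the two limits superior -/

theorem areaAt_smul (α : ℝ) {w u : Fin 2 → ℝ} {m : ℝ} (h0 : w 0 = m * u 0)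
    (h1 : w 1 = m * u 1) : areaAt α w = m ^ 2 * areaAt α u := by
  have : w 0 - α * w 1 = m * (u 0 - α * u 1) := by rw [h0, h1]; ring
  rw [areaAt, areaAt, this, h1, abs_mul, abs_mul, ← sq_abs m]
  ring

theorem areaAt_nonneg (α : ℝ) (w : Fin 2 → ℝ) : 0 ≤ areaAt α w := by
  unfold areaAt; positivity

theorem primitive_eq_of_parallel {p q p' q' : ℤ} (hq : 0 < q) (hq' : 0 < q')
    (h : IsCoprime p q) (h' : IsCoprime p' q') (e : p * q' = q * p') : p = p' ∧ q = q' := by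
  have h1 : q ∣ q' := h.symm.dvd_of_dvd_mul_left ⟨p', e⟩
  have h2 : q' ∣ q := h'.symm.dvd_of_dvd_mul_right ⟨p, by linarith⟩
  have h3 : q = q' := Int.dvd_antisymm hq.le hq'.le h1 h2
  subst h3
  exact ⟨mul_right_cancel₀ hq.ne' (by linarith), rfl⟩

theorem exists_hol_of_slopeMultiplicity (S : Origami) {p q : ℤ} (hq : 0 < q)
    (hpq : IsCoprime p q) (h : slopeMultiplicity p q S.flat ≠ ⊤) :
    ∃ w ∈ S.flat.hol, ∃ m : ℤ, m ≠ 0 ∧ w 0 = m * p ∧ w 1 = m * q ∧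
      slopeMultiplicity p q S.flat = m.natAbs := by
  obtain ⟨w, hw, hpar, hdeg⟩ := exists_degree_eq_slopeMultiplicity S h
  have hq' : (q : ℝ) ≠ 0 := by exact_mod_cast hq.ne'
  have hw1 : w 1 ≠ 0 := by
    intro h1
    rw [h1, zero_mul, sub_zero] at hpar
    have h0 : w 0 = 0 := (mul_eq_zero.1 hpar).resolve_right hq'
    refine FlatSurface.ne_zero_of_mem_hol hw ?_
    ext k
    fin_cases k
    · exact h0
    · exact h1
  obtain ⟨m, p', q', hm, hq0, hc, h0, h1⟩ := S.exists_primitive_of_mem_hol hw hw1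
  have e : p' * q = q' * p := by
    rw [h0, h1] at hpar
    have hm' : (m : ℝ) ≠ 0 := by exact_mod_cast hm
    have : (m : ℝ) * (p' * q - q' * p) = 0 := by linarith
    have := (mul_eq_zero.1 this).resolve_left hm'
    exact_mod_cast sub_eq_zero.1 this
  obtain ⟨rfl, rfl⟩ := primitive_eq_of_parallel hq0 hq hc hpq e
  exact ⟨w, hw, m, hm, h0, h1, by rw [hdeg, degree_smul_primitive hm hc h0 h1]⟩

section

variable {α : ℝ} {a : ℕ → ℕ}

/-- With `i ≥ 1` the co-slope is finite even for `n = 0`, so `M_S` controls its multiplicity. -/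
theorem intermediate_den_pos (ha : HasContinuedFraction α a) {n i : ℕ} (hi : 1 ≤ i) :
    0 < cvDen a n + i * cvDen a (n + 1) := by
  have h := cvDen_nonneg_and_one_le ha n
  have hi' : (1 : ℤ) ≤ i := by exact_mod_cast hi
  nlinarith

/-- A primitive vector close to the line of co-slope `α` is an intermediate convergent, or has a
large area. -/
theorem intermediate_or_le_areaAt (ha : HasContinuedFraction α a)
    (hα : α ∈ Set.Ioo (0 : ℝ) 1) (hirr : Irrational α) {Λ : ℝ} {n₀ : ℕ}
    (hΛ : ∀ n ≥ n₀, cfD a (n + 1) (a (n + 1)) ≤ Λ) (N : ℕ) :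
    ∃ δ > 0, ∀ p q : ℤ, 0 < q → IsCoprime p q → |(p : ℝ) - α * q| < δ →
      (∃ n ≥ N, ∃ i, 1 ≤ i ∧ i ≤ a (n + 1) ∧ p = cvNum a n + i * cvNum a (n + 1) ∧
        q = cvDen a n + i * cvDen a (n + 1)) ∨ 1 + 2 / Λ ≤ areaAt α ![(p : ℝ), q] := by
  -- The bounds at index `n` come from `hΛ` at `n - 2` and at `n`.
  obtain ⟨δ, hδ, H⟩ := exists_combination ha hα hirr (max N (n₀ + 2))
  refine ⟨δ, hδ, fun p q hq hpq hd => ?_⟩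
  obtain ⟨n, hn, b, c, hp, hq', hb, hc, hcb, hbc⟩ := H p q hq hpq hd
  by_cases hb1 : b = 1
  · left
    subst hb1
    lift c to ℕ using hc.le
    exact ⟨n, (le_max_left _ _).trans hn, c, by exact_mod_cast hc, by
      rw [mul_one] at hcb; exact_mod_cast hcb, by linarith, by linarith⟩
  · right
    have hlt := hbc.resolve_left hb1
    obtain ⟨k, rfl⟩ : ∃ k, n = k + 2 := ⟨n - 2, by omega⟩
    have hk : n₀ ≤ k := by omega
    obtain ⟨h1, h2, h3⟩ := inv_le_of_cfD_le ha hα hirr (hΛ k hk) (hΛ (k + 2) (by omega))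
    refine le_areaAt_of_two_le (b := b) (c := c) ha hα hirr ?_ ?_ ?_ ?_ ?_ h1 h2 h3
    · simp only [Matrix.cons_val_zero]; exact_mod_cast hp
    · simp only [Matrix.cons_val_one, Matrix.cons_val_zero]; exact_mod_cast hq'
    · exact_mod_cast (by omega : 2 ≤ b)
    · exact_mod_cast hc
    · exact_mod_cast hlt

/-- Only intermediate convergents need checking: `hcΛ` handles the other directions close to the
line, and a high period away from the line has a large area. It serves both for the torus and for
`S`. -/
theorem lagrangeAt_le_of_intermediate (S : Origami) (ha : HasContinuedFraction α a)
    (hα : α ∈ Set.Ioo (0 : ℝ) 1) (hirr : Irrational α) {Λ c : ℝ} {n₀ : ℕ}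
    (hΛ : ∀ n ≥ n₀, cfD a (n + 1) (a (n + 1)) ≤ Λ) (hc : 0 < c) (hcΛ : 1 ≤ c * (1 + 2 / Λ))
    (N : ℕ)
    (h : ∀ n ≥ N, ∀ i, 1 ≤ i → i ≤ a (n + 1) → ∀ w ∈ S.flat.hol, ∀ m : ℤ, m ≠ 0 →
      w 0 = m * ((cvNum a n + i * cvNum a (n + 1) : ℤ) : ℝ) →
      w 1 = m * ((cvDen a n + i * cvDen a (n + 1) : ℤ) : ℝ) → 1 ≤ c * areaAt α w) :
    lagrangeAt S α ≤ S.numSquares * ENNReal.ofReal c := by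
  refine lagrangeAt_le S α hc fun c' hc' => ?_
  have hc'0 : 0 < c' := hc.trans hc'
  obtain ⟨δ, hδ, H⟩ := intermediate_or_le_areaAt ha hα hirr hΛ N
  -- The `1` excludes horizontal periods; `1 / (c' * δ)` settles those with `|w 0 - α * w 1| ≥ δ`.
  refine ⟨max 1 (1 / (c' * δ)), fun w hw hY => ?_⟩
  rw [max_le_iff] at hY
  have hw1 : w 1 ≠ 0 := by
    intro h0
    rw [h0, abs_zero] at hY
    linarith [hY.1]
  have hcc : ∀ x, 0 ≤ x → 1 ≤ c * x → 1 ≤ c' * x := fun x hx h => by nlinarith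
  obtain ⟨m, p, q, hm, hq, hpq, h0, h1⟩ := S.exists_primitive_of_mem_hol hw hw1
  have hm1 : (1 : ℝ) ≤ |(m : ℝ)| := by exact_mod_cast Int.one_le_abs hm
  by_cases hd : |(p : ℝ) - α * q| < δ
  · apply hcc _ (areaAt_nonneg α w)
    rcases H p q hq hpq hd with ⟨n, hn, i, hi1, hi, rfl, rfl⟩ | hA
    · exact h n hn i hi1 hi w hw m hm h0 h1
    · rw [areaAt_smul α (u := ![(p : ℝ), q]) h0 h1, ← sq_abs]
      calc 1 ≤ c * (1 + 2 / Λ) := hcΛ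
        _ ≤ c * areaAt α ![(p : ℝ), q] := by gcongr
        _ ≤ c * (|(m : ℝ)| ^ 2 * areaAt α ![(p : ℝ), q]) := by
          gcongr
          exact le_mul_of_one_le_left (areaAt_nonneg _ _) (one_le_pow₀ hm1)
  · push Not at hd
    have e : w 0 - α * w 1 = m * (p - α * q) := by rw [h0, h1]; ring
    have h2 : δ ≤ |w 0 - α * w 1| := by
      rw [e, abs_mul]; nlinarith [abs_nonneg ((p : ℝ) - α * q)]
    calc (1 : ℝ) = c' * (1 / (c' * δ) * δ) := by field_simp
      _ ≤ c' * (|w 1| * |w 0 - α * w 1|) := by gcongr; exact hY.2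

end

theorem mainTheorem3 (S : Origami) (hS : S.IsReduced)
    (α : ℝ) (hα : α ∈ Set.Ioo (0 : ℝ) 1) (hirr : Irrational α)
    (a : ℕ → ℕ) (ha : HasContinuedFraction α a)
    (hL : (S.maxMultiplicity : ℝ≥0∞) ^ 2 < lagrangeAt torus α + 2) :
    lagrangeAt S α =
      (S.numSquares : ℝ≥0∞) *
        limsup (fun n : ℕ => ⨆ i ∈ Finset.Icc 1 (a n),
          ENNReal.ofReal (cfD a n i) /
            (slopeMultiplicity 1 0 (S.act (ModularGroup.S * gMatrix (cfWord a n i))) : ℝ≥0∞) ^ 2)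
          atTop := by
  have hN0 : (S.numSquares : ℝ≥0∞) ≠ 0 := by exact_mod_cast S.numSquares_pos.ne'
  have hNt : (S.numSquares : ℝ≥0∞) ≠ ⊤ := ENNReal.natCast_ne_top _
  obtain ⟨M, hM⟩ : ∃ M : ℕ, S.maxMultiplicity = M := by
    refine ENat.ne_top_iff_exists.1 (fun h => ?_) |>.imp fun _ h => h.symm
    rw [h] at hL
    simp at hL
  -- multiplicities of intermediate convergents
  have hmult : ∀ n i : ℕ, 1 ≤ i → ∃ w ∈ S.flat.hol, ∃ m : ℤ, m ≠ 0 ∧ m.natAbs ≤ M ∧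
      w 0 = m * ((cvNum a n + i * cvNum a (n + 1) : ℤ) : ℝ) ∧
      w 1 = m * ((cvDen a n + i * cvDen a (n + 1) : ℤ) : ℝ) ∧
      slopeMultiplicity 1 0 (S.act (ModularGroup.S * gMatrix (cfWord a (n + 1) i))) =
        m.natAbs := by
    intro n i hi
    have hle := slopeMultiplicity_le_max S (intermediate_den_pos ha (n := n) hi)
      (isCoprime_intermediate a n i)
    rw [hM] at hle
    obtain ⟨w, hw, m, hm, h0, h1, e⟩ := exists_hol_of_slopeMultiplicity S
      (intermediate_den_pos ha (n := n) hi) (isCoprime_intermediate a n i)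
      (ne_top_of_le_ne_top (ENat.natCast_ne_top M) hle)
    refine ⟨w, hw, m, hm, ?_, h0, h1, ?_⟩
    · rw [e] at hle; exact_mod_cast hle
    · rw [slopeMultiplicity_act_gMatrix, e]
  have hterm : ∀ (D : ℝ) (m : ℤ), m ≠ 0 → ENNReal.ofReal D / (((m.natAbs : ℕ) : ℕ∞) : ℝ≥0∞) ^ 2 =
      ENNReal.ofReal (D / (m : ℝ) ^ 2) := by
    intro D m hm
    have hm' : (m : ℝ) ≠ 0 := by exact_mod_cast hm
    rw [ENNReal.ofReal_div_of_pos (by positivity), ← sq_abs (m : ℝ),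
      ENNReal.ofReal_pow (abs_nonneg _), ← Int.cast_abs, ← Nat.cast_natAbs, ENNReal.ofReal_natCast]
    rfl
  have hareaD : ∀ n i, 1 ≤ i → i ≤ a (n + 1) → ∀ (w : Fin 2 → ℝ) (m : ℤ),
      w 0 = m * ((cvNum a n + i * cvNum a (n + 1) : ℤ) : ℝ) →
      w 1 = m * ((cvDen a n + i * cvDen a (n + 1) : ℤ) : ℝ) →
      areaAt α w * cfD a (n + 1) i = (m : ℝ) ^ 2 := by
    intro n i hi1 hi w m h0 h1
    have := areaAt_mul_cfD (n := n) ha hα hirr hi1 hi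
      (w := ![((cvNum a n + i * cvNum a (n + 1) : ℤ) : ℝ),
        ((cvDen a n + i * cvDen a (n + 1) : ℤ) : ℝ)])
      (by simp) (by simp)
    rw [areaAt_smul α (u := ![((cvNum a n + i * cvNum a (n + 1) : ℤ) : ℝ),
        ((cvDen a n + i * cvDen a (n + 1) : ℤ) : ℝ)]) h0 h1, mul_assoc, this, mul_one]
  set F := fun n : ℕ => ⨆ i ∈ Finset.Icc 1 (a n), ENNReal.ofReal (cfD a n i) /
    (slopeMultiplicity 1 0 (S.act (ModularGroup.S * gMatrix (cfWord a n i))) : ℝ≥0∞) ^ 2 with hF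
  apply le_antisymm
  · by_cases hρ : limsup F atTop = ⊤
    · rw [hρ, ENNReal.mul_top hN0]; exact le_top
    rw [mul_comm, ← ENNReal.div_le_iff hN0 hNt]
    refine ENNReal.le_of_forall_pos_le_add fun ε hε _ => ?_
    rw [ENNReal.div_le_iff hN0 hNt, mul_comm]
    obtain ⟨c, hc⟩ : ∃ c : ℝ, c = (limsup F atTop + ε).toReal := ⟨_, rfl⟩
    have hε' : (ε : ℝ≥0∞) ≠ 0 := by exact_mod_cast hε.ne'
    have hct : limsup F atTop + ε ≠ ⊤ := ENNReal.add_ne_top.2 ⟨hρ, ENNReal.coe_ne_top⟩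
    have hcr : ENNReal.ofReal c = limsup F atTop + ε := by rw [hc, ENNReal.ofReal_toReal hct]
    have hlt : limsup F atTop < ENNReal.ofReal c := by
      rw [hcr]; exact ENNReal.lt_add_right hρ hε'
    have hc0 : 0 < c := ENNReal.ofReal_pos.1 (bot_le.trans_lt hlt)
    rw [← hcr]
    obtain ⟨n₀, hn₀⟩ := eventually_atTop.1 (eventually_lt_of_limsup_lt hlt)
    have hDm : ∀ n ≥ n₀, ∀ i, 1 ≤ i → i ≤ a (n + 1) → ∀ m : ℤ, m ≠ 0 →
        slopeMultiplicity 1 0 (S.act (ModularGroup.S * gMatrix (cfWord a (n + 1) i))) =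
          m.natAbs → cfD a (n + 1) i < c * (m : ℝ) ^ 2 := by
      intro n hn i hi1 hi m hm e
      have h1 : ENNReal.ofReal (cfD a (n + 1) i) / (slopeMultiplicity 1 0
          (S.act (ModularGroup.S * gMatrix (cfWord a (n + 1) i))) : ℝ≥0∞) ^ 2 < ENNReal.ofReal c :=
        (le_iSup₂ (f := fun i (_ : i ∈ Finset.Icc 1 (a (n + 1))) =>
          ENNReal.ofReal (cfD a (n + 1) i) / (slopeMultiplicity 1 0
            (S.act (ModularGroup.S * gMatrix (cfWord a (n + 1) i))) : ℝ≥0∞) ^ 2) i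
          (Finset.mem_Icc.2 ⟨hi1, hi⟩)).trans_lt (hn₀ (n + 1) (by omega))
      have hm' : (m : ℝ) ≠ 0 := by exact_mod_cast hm
      rw [e, hterm _ m hm, ENNReal.ofReal_lt_ofReal_iff hc0, div_lt_iff₀ (by positivity)] at h1
      exact h1
    have hΛ : ∀ n ≥ n₀, ∀ i, 1 ≤ i → i ≤ a (n + 1) → cfD a (n + 1) i ≤ c * (M : ℝ) ^ 2 := by
      intro n hn i hi1 hi
      obtain ⟨w, _, m, hm, hmM, _, _, e⟩ := hmult n i hi1
      refine (hDm n hn i hi1 hi m hm e).le.trans ?_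
      have : |(m : ℝ)| ≤ M := by
        rw [← Int.cast_abs, ← Nat.cast_natAbs]; exact_mod_cast hmM
      rw [← sq_abs]
      gcongr
    have hΛ' : ∀ n ≥ n₀, cfD a (n + 1) (a (n + 1)) ≤ c * (M : ℝ) ^ 2 := fun n hn =>
      hΛ n hn _ (ha.1 (n + 1) (by omega)) le_rfl
    have hΛ0 : 0 < c * (M : ℝ) ^ 2 :=
      (cfD_pos ha hα hirr (ha.1 (n₀ + 1) (by omega)) le_rfl).trans_le (hΛ' n₀ le_rfl)
    have htorus : lagrangeAt torus α ≤ ENNReal.ofReal (c * (M : ℝ) ^ 2) := by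
      have := lagrangeAt_le_of_intermediate torus ha hα hirr hΛ' hΛ0
        (by rw [mul_add, mul_div_cancel₀ _ hΛ0.ne']; linarith) n₀ (by
          intro n hn i hi1 hi w _ m hm h0 h1
          have e := hareaD n i hi1 hi w m h0 h1
          have hm1 : (1 : ℝ) ≤ (m : ℝ) ^ 2 := by
            rw [← sq_abs]; exact one_le_pow₀ (by exact_mod_cast Int.one_le_abs hm)
          calc (1 : ℝ) ≤ areaAt α w * cfD a (n + 1) i := by rw [e]; exact hm1
            _ ≤ areaAt α w * (c * (M : ℝ) ^ 2) :=
              mul_le_mul_of_nonneg_left (hΛ n hn i hi1 hi) (areaAt_nonneg _ _)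
            _ = _ := mul_comm _ _)
      have h1 : ((torus.numSquares : ℕ) : ℝ≥0∞) = 1 := by simp [torus]
      rwa [h1, one_mul] at this
    -- The hypothesis on `L(𝕋², α)` enters here; dividing by `M²` gives `1 ≤ c (1 + 2/Λ)` with `Λ =
    -- c M²`.
    have hM2 : (M : ℝ) ^ 2 < c * (M : ℝ) ^ 2 + 2 := by
      have h1 : ((M : ℝ≥0∞)) ^ 2 < ENNReal.ofReal (c * (M : ℝ) ^ 2) + 2 := by
        refine lt_of_lt_of_le ?_ (add_le_add_left htorus 2)
        rw [hM] at hL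
        exact_mod_cast hL
      rw [← ENNReal.ofReal_natCast, ← ENNReal.ofReal_pow (Nat.cast_nonneg _),
        ← ENNReal.ofReal_ofNat 2, ← ENNReal.ofReal_add hΛ0.le (by norm_num),
        ENNReal.ofReal_lt_ofReal_iff (by positivity)] at h1
      exact h1
    have hM0 : 0 < (M : ℝ) ^ 2 := pos_of_mul_pos_right hΛ0 hc0.le
    refine lagrangeAt_le_of_intermediate S ha hα hirr hΛ' hc0 ?_ n₀ ?_
    · have : c * (1 + 2 / (c * (M : ℝ) ^ 2)) = (c * (M : ℝ) ^ 2 + 2) / (M : ℝ) ^ 2 := by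
        have hMne : (M : ℝ) ≠ 0 := fun h => by simp [h] at hM0
        field_simp
      rw [this, le_div_iff₀ hM0]
      linarith
    · intro n hn i hi1 hi w hw m hm h0 h1
      have e := hareaD n i hi1 hi w m h0 h1
      obtain ⟨w', _, m', hm', _, _, _, e'⟩ := hmult n i hi1
      have h2 := hDm n hn i hi1 hi m' hm' e'
      -- The formula contains the least multiplicity `|m'|` of the direction; any other period there
      -- has a larger area.
      have h3 : m'.natAbs ≤ m.natAbs := by
        rw [slopeMultiplicity_act_gMatrix] at e'
        have h4 := slopeMultiplicity_le_degree S hw (p := cvNum a n + i * cvNum a (n + 1))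
          (q := cvDen a n + i * cvDen a (n + 1)) (by rw [h0, h1]; ring)
        rw [e', degree_smul_primitive hm (isCoprime_intermediate a n i) h0 h1] at h4
        exact_mod_cast h4
      have h5 : (m' : ℝ) ^ 2 ≤ (m : ℝ) ^ 2 := by
        exact_mod_cast Int.natAbs_le_iff_sq_le.1 h3
      have hm2 : 0 < (m : ℝ) ^ 2 := by
        have : (m : ℝ) ≠ 0 := by exact_mod_cast hm
        positivity
      have h6 : (m : ℝ) ^ 2 * 1 ≤ (m : ℝ) ^ 2 * (c * areaAt α w) := by
        calc (m : ℝ) ^ 2 * 1 = areaAt α w * cfD a (n + 1) i := by rw [e, mul_one]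
          _ ≤ areaAt α w * (c * (m : ℝ) ^ 2) :=
            mul_le_mul_of_nonneg_left (h2.le.trans (by gcongr)) (areaAt_nonneg _ _)
          _ = _ := by ring
      exact le_of_mul_le_mul_left h6 hm2
  -- Lower bound: a term of the formula exceeding `r` is realized by a period of least multiplicity,
  -- whose height is at least the index `k`.
  · rw [mul_comm, ← ENNReal.le_div_iff_mul_le (Or.inl hN0) (Or.inl hNt)]
    refine ENNReal.le_of_forall_nnreal_lt fun r hr => ?_
    rcases eq_or_ne r 0 with rfl | hr0
    · simp
    have hr0' : (0 : ℝ) < r := by exact_mod_cast pos_iff_ne_zero.2 hr0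
    rw [ENNReal.le_div_iff_mul_le (Or.inl hN0) (Or.inl hNt), mul_comm]
    have hle := le_lagrangeAt S α hr0' (fun Y => ?_)
    · rwa [ENNReal.ofReal_coe_nnreal] at hle
    obtain ⟨K, hK⟩ := exists_nat_ge Y
    obtain ⟨n, hn, hrn⟩ := frequently_atTop.1 (frequently_lt_of_lt_limsup (by isBoundedDefault) hr)
      (K + 1)
    obtain ⟨k, rfl⟩ : ∃ k, n = k + 1 := ⟨n - 1, by omega⟩
    simp only [hF, lt_iSup_iff] at hrn
    obtain ⟨i, hi, hlt⟩ := hrn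
    rw [Finset.mem_Icc] at hi
    obtain ⟨w, hw, m, hm, _, h0, h1, e⟩ := hmult k i hi.1
    have hm' : (m : ℝ) ≠ 0 := by exact_mod_cast hm
    have hA := hareaD k i hi.1 hi.2 w m h0 h1
    have hD := cfD_pos ha hα hirr hi.1 hi.2
    rw [e, hterm _ m hm, ← ENNReal.ofReal_coe_nnreal,
      ENNReal.ofReal_lt_ofReal_iff (by positivity), lt_div_iff₀ (by positivity)] at hlt
    refine ⟨w, hw, ?_, ?_⟩
    · rw [h1, abs_mul]
      have hm1 : (1 : ℝ) ≤ |(m : ℝ)| := by exact_mod_cast Int.one_le_abs hm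
      have hQ : (k : ℤ) ≤ cvDen a k + i * cvDen a (k + 1) := by
        have h2 := le_cvDen_succ ha k
        have h3 := cvDen_nonneg_and_one_le ha k
        have h4 : (1 : ℤ) ≤ i := by exact_mod_cast hi.1
        nlinarith
      have hQ' : (k : ℝ) ≤ ((cvDen a k + i * cvDen a (k + 1) : ℤ) : ℝ) := by exact_mod_cast hQ
      have hKk : (K : ℝ) ≤ k := by exact_mod_cast (by omega : K ≤ k)
      have habs := le_abs_self (((cvDen a k + i * cvDen a (k + 1) : ℤ) : ℝ))
      nlinarith [abs_nonneg (((cvDen a k + i * cvDen a (k + 1) : ℤ) : ℝ))]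
    · have h6 : cfD a (k + 1) i * (r * areaAt α w) ≤ cfD a (k + 1) i * 1 := by
        calc _ = r * (areaAt α w * cfD a (k + 1) i) := by ring
          _ = r * (m : ℝ) ^ 2 := by rw [hA]
          _ ≤ _ := by linarith
      exact le_of_mul_le_mul_left h6 hD
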